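/- **Proposition 4.5.** Let $k$ be a field of characteristic $0$, let $\mathcal B$ be a separated scheme of finite type over $k$ with a residually finite action $\alpha_{\mathcal B}$ of $\hat{\mathbf Z}$ by $k$-automorphisms (i.e. one factoring through some $\mathbf Z/N\mathbf Z$), and let $n\ge 1$. All schemes below are separated of finite type over $k$, with residually finite $\hat{\mathbf Z}$-actions, and morphisms are equivariant over $k$. * $\mathrm{Burn}^{\hat{\mathbf Z}}(\mathcal B,\alpha_{\mathcal B})$ is the abelian group generated by the classes $[f:(X,\alpha_X)\to(\mathcal B,\alpha_{\mathcal B})]$ with $X$ smooth over $k$, with the relations $[f]=[f|_U]$ for equivariant dense open $U\subset X$, and $[X]=[Y]+[Z]$ if $X=Y\sqcup Z$. * $K_0^{\hat{\mathbf Z}}(\mathcal B,\alpha_{\mathcal B})$ is the Grothendieck ring generated by classes $[f:(X,\alpha_X)\to(\mathcal B,\alpha_{\mathcal B})]$ with relations $[X]=[Y]+[X\setminus Y]$ for equivariant closed $Y\subset X$ and product $X\times_{\mathcal B}X'$ with the diagonal action. It is filtered by the subgroups $F_d$ generated by the $[X\to\mathcal B]$ with $\dim X\le d$, and $\mathrm{gr}\,K_0^{\hat{\mathbf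 Z}}=\bigoplus_{d\ge 0}F_d/F_{d-1}$ (with $F_{-1}=0$). * $Z_n=\mathrm{Spec}\,k^n=\{a_1,\dots,a_n\}$, and $\Phi_n(\alpha_X)$ is the residually finite action on $X\times Z_n$ for which $1\in\hat{\mathbf Z}$ acts by the Verschiebung $(x,a_i)\mapsto(x,a_{i+1})$ for $i<n$, $(x,a_n)\mapsto(\alpha_X(1)x,a_1)$. * On both groups, $\sigma_n$ and $\tilde\rho_n$ are the additive maps (with $\sigma_n$ a ring homomorphism on $K_0^{\hat{\mathbf Z}}$), with targets the corresponding groups of $(\mathcal B,\alpha_{\mathcal B}\circ\sigma_n)$ and of $(\mathcal B\times Z_n,\Phi_n(\alpha_{\mathcal B}))$, given by $$\sigma_n[f:(X,\alpha_X)\to(\mathcal B,\alpha_{\mathcal B})]=[f:(X,\alpha_X\circ\sigma_n)\to(\mathcal B,\alpha_{\mathcal B}\circ\sigma_n)],$$ $$\tilde\rho_n[f:(X,\alpha_X)\to(\mathcal B,\alpha_{\mathcal B})]=[f\times\mathrm{id}:(X\times Z_n,\Phi_n(\alpha_X))\to(\mathcal B\times Z_n,\Phi_n(\alpha_{\mathcal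 B}))],$$ where $\alpha\circ\sigma_n$ is the action $\alpha$ precomposed with multiplication by $n$ on $\hat{\mathbf Z}$. For every $(\mathcal B,\alpha_{\mathcal B})$ there is a unique homomorphism of abelian groups $$\Psi_{(\mathcal B,\alpha_{\mathcal B})}:\mathrm{Burn}^{\hat{\mathbf Z}}(\mathcal B,\alpha_{\mathcal B})\to \mathrm{gr}\,K_0^{\hat{\mathbf Z}}(\mathcal B,\alpha_{\mathcal B})$$ that sends $[X\to\mathcal B]$, for $X$ smooth over $k$ of pure dimension $d$, to the class of $[X\to\mathcal B]$ in $F_d/F_{d-1}$. For every $n\ge1$ the maps $\sigma_n$ and $\tilde\rho_n$ on $K_0^{\hat{\mathbf Z}}(\mathcal B,\alpha_{\mathcal B})$ preserve the filtrations by dimension, and the induced maps on the associated graded groups satisfy $$\mathrm{gr}(\sigma_n)\circ\Psi_{(\mathcal B,\alpha_{\mathcal B})}=\Psi_{(\mathcal B,\alpha_{\mathcal B}\circ\sigma_n)}\circ\sigma_n,\qquad \mathrm{gr}(\tilde\rho_n)\circ\Psi_{(\mathcal B,\alpha_{\mathcal B})}=\Psi_{(\mathcal B\times Z_n,\Phi_n(\alpha_{\mathcal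 B}))}\circ\tilde\rho_n .$$ -/

import Mathlib

open CategoryTheory CategoryTheory.Limits AlgebraicGeometry

universe u

noncomputable section

namespace BostConnes

/-! ### The profinite integers -/

/-- The profinite completion `Ẑ = lim ℤ/N` of the integers: compatible families of residues. -/
def ZHat : AddSubgroup (∀ N : ℕ+, ZMod N) where
  carrier := {x | ∀ (M N : ℕ+) (h : (M : ℕ) ∣ N), ZMod.castHom h (ZMod M) (x N) = x M}
  zero_mem' := fun M N h => by simp
  add_mem' := fun hx hy M N h => by
    rw [Pi.add_apply, Pi.add_apply, map_add, hx M N h, hy M N h]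
  neg_mem' := fun hx M N h => by rw [Pi.neg_apply, Pi.neg_apply, map_neg, hx M N h]

namespace ZHat

/-- The reduction `Ẑ → ℤ/N`. -/
def proj (N : ℕ+) : ZHat →+ ZMod N := (Pi.evalAddMonoidHom _ N).comp ZHat.subtype

/-- The topological generator `1 ∈ Ẑ`. -/
def one : ZHat := ⟨fun _ => 1, fun _ _ _ => map_one _⟩

@[simp] lemma proj_one (N : ℕ+) : proj N one = 1 := rfl

lemma castHom_proj {M N : ℕ+} (h : (M : ℕ) ∣ N) (z : ZHat) :
    ZMod.castHom h (ZMod M) (proj N z) = proj M z := z.2 M N h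

/-- The endomorphism "multiplication by `n`" of `Ẑ`. -/
def mulHom (n : ℕ) : ZHat →+ ZHat := nsmulAddMonoidHom n

end ZHat

/-! ### Residually finite actions -/

/-- A residually finite action of `Ẑ` on an object `X` of a category: an action (by automorphisms)
that factors through a finite quotient `ℤ/N` of `Ẑ`. -/
structure ZHatAction {C : Type*} [Category C] (X : C) where
  /-- the action itself -/
  toHom : Multiplicative ZHat →* Aut X
  exists_factor : ∃ (N : ℕ+) (φ : Multiplicative (ZMod N) →* Aut X),
    ∀ z : ZHat, toHom (Multiplicative.ofAdd z) = φ (Multiplicative.ofAdd (ZHat.proj N z))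

namespace ZHatAction

variable {C : Type*} [Category C] {X Y : C}

/-- The automorphism by which `z ∈ Ẑ` acts. -/
def act (α : ZHatAction X) (z : ZHat) : Aut X := α.toHom (Multiplicative.ofAdd z)

lemma hom_mul (g h : Aut X) : (g * h).hom = h.hom ≫ g.hom := rfl

lemma exists_pow (α : ZHatAction X) :
    ∃ N : ℕ+, ∀ (z : ZHat) (m : ℕ), ZHat.proj N z = m → α.act z = α.act ZHat.one ^ m := by
  obtain ⟨N, φ, h⟩ := α.exists_factor
  refine ⟨N, fun z m hm => ?_⟩
  rw [act, act, h, h, hm, ← map_pow, ZHat.proj_one, ← ofAdd_nsmul, nsmul_one]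

lemma isOfFinOrder_act_one (α : ZHatAction X) : IsOfFinOrder (α.act ZHat.one) := by
  obtain ⟨N, h⟩ := α.exists_pow
  refine isOfFinOrder_iff_pow_eq_one.2 ⟨N, N.pos, ?_⟩
  rw [← h 0 N (by simp)]
  exact map_one α.toHom

/-- A morphism that commutes with the action of `1 ∈ Ẑ` commutes with the action of `Ẑ`. -/
lemma comm_of_one (α : ZHatAction X) (β : ZHatAction Y) (f : X ⟶ Y)
    (h : (α.act ZHat.one).hom ≫ f = f ≫ (β.act ZHat.one).hom) (z : ZHat) :
    (α.act z).hom ≫ f = f ≫ (β.act z).hom := by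
  obtain ⟨M, hM⟩ := α.exists_pow
  obtain ⟨N, hN⟩ := β.exists_pow
  have hz : ((ZHat.proj (M * N) z).val : ZMod (M * N : ℕ+)) = ZHat.proj (M * N) z :=
    ZMod.natCast_zmod_val _
  have h1 : ((M : ℕ) ∣ (M * N : ℕ+)) := ⟨N, by simp⟩
  have h2 : ((N : ℕ) ∣ (M * N : ℕ+)) := ⟨M, by simp [mul_comm]⟩
  rw [hM z (ZHat.proj (M * N) z).val (by rw [← ZHat.castHom_proj h1, ← map_natCast
      (ZMod.castHom h1 (ZMod M)), hz]),
    hN z (ZHat.proj (M * N) z).val (by rw [← ZHat.castHom_proj h2, ← map_natCast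
      (ZMod.castHom h2 (ZMod N)), hz])]
  generalize (ZHat.proj (M * N) z).val = m
  induction m with
  | zero => exact (Category.id_comp f).trans (Category.comp_id f).symm
  | succ m ih =>
    rw [pow_succ', pow_succ', hom_mul, hom_mul, Category.assoc, h, ← Category.assoc, ih,
      Category.assoc]

lemma exists_act_eq_one (α : ZHatAction X) :
    ∃ N : ℕ+, ∀ z : ZHat, ZHat.proj N z = 0 → α.act z = 1 := by
  obtain ⟨N, h⟩ := α.exists_pow
  exact ⟨N, fun z hz => by rw [h z 0 (by simpa using hz), pow_zero]⟩

/-- A homomorphism that is trivial on the kernel of `Ẑ → ℤ/N` factors through `ℤ/N`. -/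
lemma exists_factor_of_ker {G : Type*} [Group G] (f : Multiplicative ZHat →* G) (N : ℕ+)
    (h : ∀ z : ZHat, ZHat.proj N z = 0 → f (Multiplicative.ofAdd z) = 1) :
    ∃ (N : ℕ+) (φ : Multiplicative (ZMod N) →* G),
      ∀ z : ZHat, f (Multiplicative.ofAdd z) = φ (Multiplicative.ofAdd (ZHat.proj N z)) := by
  have hN : zmultiplesHom (Additive G) (Additive.ofMul (f (Multiplicative.ofAdd ZHat.one))) N
      = 0 := by
    rw [zmultiplesHom_apply, natCast_zsmul, ← ofMul_pow, ← map_pow, ← ofAdd_nsmul, h, ofMul_one]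
    simp
  refine ⟨N, AddMonoidHom.toMultiplicativeLeft (ZMod.lift N ⟨_, hN⟩), fun z => ?_⟩
  obtain ⟨m, hm⟩ := ZMod.intCast_surjective (ZHat.proj N z)
  have h1 : f (Multiplicative.ofAdd (z - m • ZHat.one)) = 1 := h _ (by
    rw [map_sub, map_zsmul, ZHat.proj_one, zsmul_one, hm, sub_self])
  rw [ofAdd_sub, map_div, div_eq_one] at h1
  have h2 := ZMod.lift_coe N ⟨_, hN⟩ m
  rw [hm] at h2
  refine h1.trans (Eq.symm ((congrArg Additive.toMul h2).trans ?_))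
  simp

/-- The action `α ∘ σ_n`, where `σ_n` is the multiplication by `n` on `Ẑ`. -/
def compMul (α : ZHatAction X) (n : ℕ) : ZHatAction X where
  toHom := α.toHom.comp (AddMonoidHom.toMultiplicative (ZHat.mulHom n))
  exists_factor := by
    obtain ⟨N, φ, h⟩ := α.exists_factor
    refine ⟨N, φ.comp (AddMonoidHom.toMultiplicative (nsmulAddMonoidHom n)), fun z => ?_⟩
    refine (h (n • z)).trans ?_
    rw [map_nsmul]
    rfl

/-- The residually finite action of `Ẑ` in which `1 ∈ Ẑ` acts by a given automorphism `g` of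
finite order (so that `z ∈ Ẑ` acts by `g ^ m` for any integer `m ≡ z` modulo the order of `g`). -/
def ofFinOrder (g : Aut X) (hg : IsOfFinOrder g) : ZHatAction X where
  toHom := AddMonoidHom.toMultiplicativeLeft
    ((ZMod.lift (orderOf g) ⟨zmultiplesHom _ (Additive.ofMul g), by
      simp [← ofMul_pow, pow_orderOf_eq_one]⟩).comp (ZHat.proj ⟨orderOf g, hg.orderOf_pos⟩))
  exists_factor := ⟨⟨orderOf g, hg.orderOf_pos⟩, AddMonoidHom.toMultiplicativeLeft
    (ZMod.lift (orderOf g) ⟨zmultiplesHom _ (Additive.ofMul g), by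
      simp [← ofMul_pow, pow_orderOf_eq_one]⟩), fun _ => rfl⟩

@[simp] lemma ofFinOrder_act_one (g : Aut X) (hg : IsOfFinOrder g) :
    (ofFinOrder g hg).act ZHat.one = g := by
  have := ZMod.lift_coe (orderOf g) ⟨zmultiplesHom _ (Additive.ofMul g), by
      simp [← ofMul_pow, pow_orderOf_eq_one]⟩ 1
  rw [Int.cast_one] at this
  refine Eq.trans (congrArg Additive.toMul this) ?_
  simp

end ZHatAction

/-! ### Schemes over `k` with a residually finite action -/

variable (k : Type u) [Field k]

/-- Separated schemes of finite type over `k` endowed with a residually finite action of `Ẑ`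
(by automorphisms over `k`). -/
structure EqSch where
  /-- the underlying `k`-scheme -/
  sch : Over (Spec (CommRingCat.of k))
  isSeparated : IsSeparated sch.hom
  locallyOfFiniteType : LocallyOfFiniteType sch.hom
  quasiCompact : QuasiCompact sch.hom
  /-- the action of `Ẑ` -/
  action : ZHatAction sch

variable {k}

namespace EqSch

attribute [instance] EqSch.isSeparated EqSch.locallyOfFiniteType EqSch.quasiCompact

/-- `Ẑ`-equivariant morphisms over `k`. -/
@[ext]
structure Hom (X Y : EqSch k) where
  /-- the underlying morphism over `k` -/
  hom : X.sch ⟶ Y.sch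
  equivariant : ∀ z : ZHat, (X.action.act z).hom ≫ hom = hom ≫ (Y.action.act z).hom

instance : Category (EqSch k) where
  Hom := Hom
  id X := ⟨𝟙 _, fun z => by rw [Category.comp_id, Category.id_comp]⟩
  comp f g := ⟨f.hom ≫ g.hom, fun z => by
    rw [← Category.assoc, f.equivariant, Category.assoc, g.equivariant, Category.assoc]⟩
  id_comp f := Hom.ext (Category.id_comp _)
  comp_id f := Hom.ext (Category.comp_id _)
  assoc f g h := Hom.ext (Category.assoc _ _ _)

/-- The morphism of schemes underlying an equivariant morphism. -/
def schHom {X Y : EqSch k} (f : X ⟶ Y) : X.sch.left ⟶ Y.sch.left := f.hom.left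

/-- The functor `(X, α) ↦ (X, α ∘ σ_n)`. -/
def sigma (n : ℕ) : EqSch k ⥤ EqSch k where
  obj X := { X with action := X.action.compMul n }
  map f := ⟨f.hom, fun z => f.equivariant (n • z)⟩

end EqSch

/-! ### The schemes `X × Z_n` and the Verschiebung -/

variable (k) in
/-- `Z_n = Spec k^n`, as a `k`-scheme. -/
def Zn (n : ℕ) : Over (Spec (CommRingCat.of k)) :=
  Over.mk (Spec.map (CommRingCat.ofHom (algebraMap k (Fin n → k))))

variable (k) in
/-- The `i`-th `k`-point of `Z_n`. -/
def ZnPoint (n : ℕ) (i : Fin n) : Spec (CommRingCat.of k) ⟶ (Zn k n).left :=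
  Spec.map (CommRingCat.ofHom (Pi.evalRingHom (fun _ : Fin n => k) i))

lemma ZnPoint_hom (n : ℕ) (i : Fin n) : ZnPoint k n i ≫ (Zn k n).hom = 𝟙 _ := by
  refine (Spec.map_comp _ _).symm.trans (Eq.trans ?_ (Spec.map_id _))
  rfl

/-- The product `X × Z_n` over `k`. -/
def prodZn (X : Over (Spec (CommRingCat.of k))) (n : ℕ) : Over (Spec (CommRingCat.of k)) :=
  Over.mk (pullback.fst X.hom (Zn k n).hom ≫ X.hom)

/-- The projection `X × Z_n → X`. -/
def prodZnFst (X : Over (Spec (CommRingCat.of k))) (n : ℕ) : prodZn X n ⟶ X :=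
  Over.homMk (pullback.fst X.hom (Zn k n).hom) rfl

/-- The projection `X × Z_n → Z_n`. -/
def prodZnSnd (X : Over (Spec (CommRingCat.of k))) (n : ℕ) : prodZn X n ⟶ Zn k n :=
  Over.homMk (pullback.snd X.hom (Zn k n).hom) pullback.condition.symm

lemma prodZn_isPullback (X : Over (Spec (CommRingCat.of k))) (n : ℕ) :
    IsPullback (prodZnFst X n).left (prodZnSnd X n).left X.hom (Zn k n).hom :=
  IsPullback.of_hasPullback _ _

lemma prodZn_ext {X T : Over (Spec (CommRingCat.of k))} {n : ℕ} {f g : T ⟶ prodZn X n}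
    (h₁ : f ≫ prodZnFst X n = g ≫ prodZnFst X n)
    (h₂ : f ≫ prodZnSnd X n = g ≫ prodZnSnd X n) : f = g := by
  ext1
  exact (prodZn_isPullback X n).hom_ext (congrArg (·.left) h₁) (congrArg (·.left) h₂)

/-- The morphism to `X × Z_n` with given components. -/
def prodZnLift {X T : Over (Spec (CommRingCat.of k))} {n : ℕ} (f : T ⟶ X) (g : T ⟶ Zn k n) :
    T ⟶ prodZn X n :=
  Over.homMk (pullback.lift f.left g.left ((Over.w f).trans (Over.w g).symm))
    ((pullback.lift_fst_assoc _ _ _ _).trans (Over.w f))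

@[simp]
lemma prodZnLift_fst {X T : Over (Spec (CommRingCat.of k))} {n : ℕ} (f : T ⟶ X)
    (g : T ⟶ Zn k n) : prodZnLift f g ≫ prodZnFst X n = f := by
  ext1
  exact pullback.lift_fst _ _ _

@[simp]
lemma prodZnLift_fst_assoc {X T S : Over (Spec (CommRingCat.of k))} {n : ℕ} (f : T ⟶ X)
    (g : T ⟶ Zn k n) (h : X ⟶ S) : prodZnLift f g ≫ prodZnFst X n ≫ h = f ≫ h := by
  rw [← Category.assoc, prodZnLift_fst]

@[simp]
lemma prodZnLift_snd {X T : Over (Spec (CommRingCat.of k))} {n : ℕ} (f : T ⟶ X)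
    (g : T ⟶ Zn k n) : prodZnLift f g ≫ prodZnSnd X n = g := by
  ext1
  exact pullback.lift_snd _ _ _

/-- The morphism `f × id : X × Z_n → Y × Z_n`. -/
def prodZnMap {X Y : Over (Spec (CommRingCat.of k))} (f : X ⟶ Y) (n : ℕ) :
    prodZn X n ⟶ prodZn Y n :=
  prodZnLift (prodZnFst X n ≫ f) (prodZnSnd X n)

/-- The inclusion of the `i`-th copy of `X` in `X × Z_n`, namely `x ↦ (x, a_i)`, where `a_i` is
the `i`-th point of `Z_n`. -/
def copyIncl (X : Over (Spec (CommRingCat.of k))) (n : ℕ) (i : Fin n) : X ⟶ prodZn X n :=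
  prodZnLift (𝟙 X) (Over.homMk (X.hom ≫ ZnPoint k n i) (by
    rw [Category.assoc, ZnPoint_hom, Category.comp_id]))

lemma copyIncl_map {X Y : Over (Spec (CommRingCat.of k))} (f : X ⟶ Y) (n : ℕ) (i : Fin n) :
    copyIncl X n i ≫ prodZnMap f n = f ≫ copyIncl Y n i := by
  apply prodZn_ext
  · simp [copyIncl, prodZnMap]
  · simp only [copyIncl, prodZnMap, Category.assoc, prodZnLift_snd]
    ext1
    exact (Over.w_assoc f _).symm

lemma copyIncl_map_assoc {X Y T : Over (Spec (CommRingCat.of k))} (f : X ⟶ Y) (n : ℕ) (i : Fin n)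
    (h : prodZn Y n ⟶ T) : copyIncl X n i ≫ prodZnMap f n ≫ h = f ≫ copyIncl Y n i ≫ h := by
  rw [← Category.assoc, copyIncl_map, Category.assoc]

lemma copyIncl_isPullback (X : Over (Spec (CommRingCat.of k))) (n : ℕ) (i : Fin n) :
    IsPullback X.hom (copyIncl X n i).left (ZnPoint k n i) (prodZnSnd X n).left := by
  refine (IsPullback.of_right ?_ ?_ (prodZn_isPullback X n)).flip
  · rw [ZnPoint_hom]
    have : (copyIncl X n i).left ≫ (prodZnFst X n).left = 𝟙 _ :=
      congrArg (fun f : X ⟶ X => f.left) (prodZnLift_fst _ _)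
    rw [this]
    exact IsPullback.id_horiz _
  · exact congrArg (fun f : X ⟶ Zn k n => f.left) (prodZnLift_snd (𝟙 X) _)

lemma isOpenImmersion_ZnPoint (n : ℕ) (i : Fin n) : IsOpenImmersion (ZnPoint k n i) := by
  let := (Pi.evalRingHom (fun _ : Fin n => k) i).toAlgebra
  have : IsLocalization.Away (Pi.single i 1 : Fin n → k) k := by
    apply IsLocalization.away_of_isIdempotentElem_of_mul
    · ext j; by_cases h : j = i
      · subst h; simp
      · simp [h]
    · intro x y
      constructor
      · intro (e : x i = y i)
        ext j; by_cases h : j = i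
        · subst h; simp [e]
        · simp [h]
      · intro e
        have h : (Pi.single i (1 : k) : Fin n → k) i * x i =
          (Pi.single i (1 : k) : Fin n → k) i * y i := congr_fun e i
        rw [Pi.single_eq_same, one_mul, one_mul] at h
        exact h
    · exact Function.surjective_eval _
  exact IsOpenImmersion.of_isLocalization (Pi.single i 1 : Fin n → k)

lemma isIso_desc_ZnPoint (n : ℕ) : IsIso (Sigma.desc (fun i : Fin n => ZnPoint k n i)) := by
  have hopen (i : Fin n) : IsOpenImmersion (ZnPoint k n i) := isOpenImmersion_ZnPoint n i
  have : IsOpenImmersion (Sigma.desc (fun i : Fin n => ZnPoint k n i)) := by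
    apply isOpenImmersion_sigmaDesc
    intro i j hij
    refine Set.disjoint_iff_forall_ne.mpr ?_
    rintro _ ⟨x, rfl⟩ _ ⟨y, rfl⟩ e
    have h : (Pi.single j 1 : Fin n → k) ∈ (ZnPoint k n i x : PrimeSpectrum (Fin n → k)).asIdeal := by
      change (Pi.single j 1 : Fin n → k) i ∈ (x : PrimeSpectrum k).asIdeal
      simp [hij]
    rw [e] at h
    change (Pi.single j 1 : Fin n → k) j ∈ (y : PrimeSpectrum k).asIdeal at h
    rw [Pi.single_eq_same] at h
    exact (y : PrimeSpectrum k).2.ne_top ((Ideal.eq_top_iff_one _).2 h)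
  apply isIso_of_isOpenImmersion_of_opensRange_eq_top
  rw [eq_top_iff]
  rintro (x : PrimeSpectrum (Fin n → k)) -
  obtain ⟨i, hi⟩ : ∃ i : Fin n, Pi.single i (1 : k) ∉ x.asIdeal := by
    by_contra! h
    apply x.2.ne_top
    rw [Ideal.eq_top_iff_one, ← Finset.univ_sum_single (1 : Fin n → k)]
    exact Ideal.sum_mem _ fun i _ => h i
  have hx : ZnPoint k n i (⊥ : PrimeSpectrum k) = x := by
    refine PrimeSpectrum.ext (Ideal.ext fun f => ?_)
    change f i ∈ (⊥ : Ideal k) ↔ f ∈ x.asIdeal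
    constructor
    · intro (h : f i = 0)
      have : Pi.single i (1 : k) * f = 0 := by
        ext j
        by_cases hj : j = i
        · subst hj; simp [h]
        · simp [hj]
      exact (x.2.mem_or_mem (this ▸ Ideal.zero_mem _)).resolve_left hi
    · intro h
      by_contra (h0 : ¬ f i = 0)
      apply hi
      have : Pi.single i (1 : k) = Pi.single i (f i)⁻¹ * f := by
        ext j
        by_cases hj : j = i
        · subst hj; simp [h0]
        · simp [hj]
      rw [this]
      exact Ideal.mul_mem_left _ _ h
  refine ⟨Sigma.ι (fun _ : Fin n => Spec (CommRingCat.of k)) i (⊥ : PrimeSpectrum k), ?_⟩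
  refine (Scheme.Hom.comp_apply _ _ _).symm.trans ?_
  rw [Sigma.ι_desc]
  exact hx

/-- `X × Z_n` is the disjoint union of `n` copies of `X`. -/
def copyIsColimit (X : Over (Spec (CommRingCat.of k))) (n : ℕ) :
    IsColimit (Cofan.mk (prodZn X n).left (fun i : Fin n => (copyIncl X n i).left)) := by
  have hau : IsUniversalColimit (Cofan.mk (Zn k n).left (fun i : Fin n => ZnPoint k n i)) :=
    FinitaryPreExtensive.isUniversal_finiteCoproducts
      ((Cofan.nonempty_isColimit_iff_isIso_sigmaDesc _).mpr (isIso_desc_ZnPoint n)).some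
  exact (hau.nonempty_isColimit_of_isPullback_left (fun _ => 𝟙 _) (Zn k n).hom X.hom
    (fun _ => 𝟙 X.left) (fun _ => X.hom) (fun _ => IsPullback.id_horiz _)
    (prodZn_isPullback X n) (Cofan.mk (prodZn X n).left (fun i : Fin n => (copyIncl X n i).left))
    (Iso.refl _) (fun i => ZnPoint_hom n i)
    (fun i => congrArg (fun f : X ⟶ X => f.left) (prodZnLift_fst _ _))
    (fun i => congrArg (fun f : X ⟶ Zn k n => f.left) (prodZnLift_snd (𝟙 X) _))).some

lemma copy_hom_ext {X T : Over (Spec (CommRingCat.of k))} {n : ℕ} {f g : prodZn X n ⟶ T}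
    (h : ∀ i, copyIncl X n i ≫ f = copyIncl X n i ≫ g) : f = g := by
  ext1
  exact Cofan.IsColimit.hom_ext (copyIsColimit X n) _ _
    (fun i => congrArg (fun f : X ⟶ T => f.left) (h i))

/-- The morphism out of `X × Z_n` with given restrictions to the `n` copies of `X`. -/
def copyDesc {X T : Over (Spec (CommRingCat.of k))} {n : ℕ} (f : Fin n → (X ⟶ T)) :
    prodZn X n ⟶ T :=
  Over.homMk (Cofan.IsColimit.desc (copyIsColimit X n) (fun i => (f i).left))
    (Cofan.IsColimit.hom_ext (copyIsColimit X n) _ _ (fun i => by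
      rw [Cofan.IsColimit.fac_assoc, Over.w]
      exact (Over.w (copyIncl X n i)).symm))

@[simp]
lemma copyIncl_desc {X T : Over (Spec (CommRingCat.of k))} {n : ℕ} (f : Fin n → (X ⟶ T))
    (i : Fin n) : copyIncl X n i ≫ copyDesc f = f i := by
  ext1
  exact Cofan.IsColimit.fac (copyIsColimit X n) _ i

lemma copyIncl_desc_assoc {X T S : Over (Spec (CommRingCat.of k))} {n : ℕ}
    (f : Fin n → (X ⟶ T)) (i : Fin n) (h : T ⟶ S) :
    copyIncl X n i ≫ copyDesc f ≫ h = f i ≫ h := by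
  rw [← Category.assoc, copyIncl_desc]

/-- The geometric Verschiebung of an endomorphism `a` of `X`: the endomorphism of `X × Z_n` with
`(x, a_i) ↦ (x, a_{i+1})` for `i` not the last index and `(x, a_i) ↦ (a x, a_0)` for the last one
(the points of `Z_n` are numbered `a_0, …, a_{n-1}`). -/
def verschiebung {X : Over (Spec (CommRingCat.of k))} (n : ℕ) (a : X ⟶ X) :
    prodZn X n ⟶ prodZn X n :=
  copyDesc (fun i => if h : (i : ℕ) + 1 < n then copyIncl X n ⟨i + 1, h⟩
    else a ≫ copyIncl X n ⟨0, i.pos⟩)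

/-- The composite of `a ^ (m / n)` and the inclusion of the copy with index `m % n`. -/
def orbitMap {X : Over (Spec (CommRingCat.of k))} (n : ℕ) (hn : 0 < n) (a : End X) (m : ℕ) :
    X ⟶ prodZn X n :=
  End.asHom (a ^ (m / n)) ≫ copyIncl X n ⟨m % n, Nat.mod_lt _ hn⟩

lemma orbitMap_verschiebung {X : Over (Spec (CommRingCat.of k))} (n : ℕ) (hn : 0 < n) (a : End X)
    (m : ℕ) : orbitMap n hn a m ≫ verschiebung n a = orbitMap n hn a (m + 1) := by
  rw [orbitMap, verschiebung, Category.assoc, copyIncl_desc]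
  by_cases h : m % n + 1 < n
  · rw [dif_pos h]
    have h1 : (m + 1) % n = m % n + 1 := by
      rw [Nat.add_mod, Nat.mod_eq_of_lt (a := m % n + 1 % n)]
      · rw [Nat.mod_eq_of_lt (a := 1)]; omega
      · rw [Nat.mod_eq_of_lt (a := 1)] <;> omega
    have h2 : (m + 1) / n = m / n := by
      rw [Nat.succ_div_of_not_dvd]
      rw [Nat.dvd_iff_mod_eq_zero]
      omega
    simp only [orbitMap, h1, h2]
  · rw [dif_neg h]
    have h0 : n ∣ m + 1 := by
      have := Nat.mod_lt m hn
      have h3 : m % n + 1 = n := by omega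
      refine ⟨m / n + 1, ?_⟩
      have := Nat.div_add_mod m n
      rw [mul_add, mul_one]
      omega
    have h1 : (m + 1) % n = 0 := Nat.mod_eq_zero_of_dvd h0
    have h2 : (m + 1) / n = m / n + 1 := Nat.succ_div_of_dvd h0
    simp only [orbitMap, h1, h2, pow_succ', End.mul_def]
    exact (Category.assoc _ _ _).symm

lemma orbitMap_verschiebung_pow {X : Over (Spec (CommRingCat.of k))} (n : ℕ) (hn : 0 < n)
    (a : End X) (m r : ℕ) :
    orbitMap n hn a m ≫ End.asHom (End.of (verschiebung n a) ^ r) = orbitMap n hn a (m + r) := by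
  induction r with
  | zero => exact Category.comp_id _
  | succ r ih =>
    rw [pow_succ', End.mul_def]
    refine (Category.assoc _ _ _).symm.trans ?_
    refine (congrArg (· ≫ verschiebung n a) ih).trans ?_
    exact orbitMap_verschiebung n hn a (m + r)

lemma verschiebung_pow {X : Over (Spec (CommRingCat.of k))} (n : ℕ) (hn : 0 < n) (a : End X)
    (N : ℕ) (ha : a ^ N = 1) : End.of (verschiebung n a) ^ (n * N) = 1 := by
  refine copy_hom_ext (fun i => ?_)
  have hi : copyIncl X n i = orbitMap n hn a i := by
    simp only [orbitMap, Nat.div_eq_of_lt i.2, Nat.mod_eq_of_lt i.2, pow_zero]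
    exact (Category.id_comp _).symm
  rw [hi]
  refine (orbitMap_verschiebung_pow n hn a i (n * N)).trans ?_
  refine Eq.trans ?_ (Category.comp_id _).symm
  simp only [orbitMap, Nat.add_mul_div_left _ _ hn, Nat.add_mul_mod_self_left, pow_add, ha,
    mul_one]

lemma isUnit_verschiebung {X : Over (Spec (CommRingCat.of k))} (n : ℕ) (hn : 0 < n) (a : Aut X)
    (ha : IsOfFinOrder a) : IsUnit (End.of (verschiebung n a.hom)) := by
  refine IsUnit.of_pow_eq_one (n := n * orderOf a) (verschiebung_pow n hn (End.of a.hom) _ ?_)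
    (Nat.mul_pos hn ha.orderOf_pos).ne'
  have := congrArg (Aut.toEnd X) (pow_orderOf_eq_one a)
  rwa [map_pow, map_one] at this

/-- The Verschiebung of an automorphism of finite order, as an automorphism of `X × Z_n`. -/
def verschiebungAut {X : Over (Spec (CommRingCat.of k))} (n : ℕ) (hn : 0 < n) (a : Aut X)
    (ha : IsOfFinOrder a) : Aut (prodZn X n) :=
  Aut.unitsEndEquivAut _ (isUnit_verschiebung n hn a ha).unit

lemma verschiebungAut_hom {X : Over (Spec (CommRingCat.of k))} (n : ℕ) (hn : 0 < n) (a : Aut X)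
    (ha : IsOfFinOrder a) : (verschiebungAut n hn a ha).hom = verschiebung n a.hom := rfl

lemma isOfFinOrder_verschiebungAut {X : Over (Spec (CommRingCat.of k))} (n : ℕ) (hn : 0 < n)
    (a : Aut X) (ha : IsOfFinOrder a) : IsOfFinOrder (verschiebungAut n hn a ha) := by
  refine isOfFinOrder_iff_pow_eq_one.2 ⟨n * orderOf a, Nat.mul_pos hn ha.orderOf_pos, ?_⟩
  rw [verschiebungAut, ← map_pow, EmbeddingLike.map_eq_one_iff, Units.ext_iff, Units.val_pow_eq_pow_val,
    IsUnit.unit_spec]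
  refine verschiebung_pow n hn (End.of a.hom) _ ?_
  have := congrArg (Aut.toEnd X) (pow_orderOf_eq_one a)
  rwa [map_pow, map_one] at this

/-- The residually finite action `Φ_n(α)` of `Ẑ` on `X × Z_n`, in which `1 ∈ Ẑ` acts by the
geometric Verschiebung of the automorphism by which `1` acts on `X`. -/
def Phi {X : Over (Spec (CommRingCat.of k))} (n : ℕ) (hn : 0 < n) (α : ZHatAction X) :
    ZHatAction (prodZn X n) :=
  ZHatAction.ofFinOrder (verschiebungAut n hn (α.act ZHat.one) α.isOfFinOrder_act_one)
    (isOfFinOrder_verschiebungAut n hn _ _)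

lemma verschiebung_map {X Y : Over (Spec (CommRingCat.of k))} (n : ℕ) (a : X ⟶ X) (b : Y ⟶ Y)
    (f : X ⟶ Y) (h : a ≫ f = f ≫ b) :
    verschiebung n a ≫ prodZnMap f n = prodZnMap f n ≫ verschiebung n b := by
  refine copy_hom_ext (fun i => ?_)
  rw [copyIncl_map_assoc, verschiebung, verschiebung, copyIncl_desc_assoc, copyIncl_desc]
  split_ifs with hi
  · exact copyIncl_map f n _
  · rw [Category.assoc, copyIncl_map, ← Category.assoc, h, Category.assoc]

instance (n : ℕ) : IsFinite (Zn k n).hom :=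
  (IsFinite.SpecMap_iff _).2 (RingHom.finite_algebraMap.2 inferInstance)

instance (n : ℕ) : Etale (Zn k n).hom :=
  (HasRingHomProperty.Spec_iff (P := @Etale)).2 (RingHom.etale_algebraMap.2 inferInstance)

instance (X : Over (Spec (CommRingCat.of k))) (n : ℕ) : Etale (prodZnFst X n).left :=
  inferInstanceAs (Etale (pullback.fst _ _))

instance (X : Over (Spec (CommRingCat.of k))) (n : ℕ) : IsFinite (prodZnFst X n).left :=
  inferInstanceAs (IsFinite (pullback.fst _ _))

lemma prodZnMap_isPullback {X Y : Over (Spec (CommRingCat.of k))} (f : X ⟶ Y) (n : ℕ) :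
    IsPullback (prodZnMap f n).left (prodZnFst X n).left (prodZnFst Y n).left f.left := by
  refine IsPullback.of_right ?_ ?_ (prodZn_isPullback Y n).flip
  · have h : (prodZnMap f n).left ≫ (prodZnSnd Y n).left = (prodZnSnd X n).left :=
      congrArg (fun g : prodZn X n ⟶ Zn k n => g.left) (prodZnLift_snd _ _)
    rw [h, Over.w]
    exact (prodZn_isPullback X n).flip
  · exact congrArg (fun g : prodZn X n ⟶ Y => g.left) (prodZnLift_fst _ _)

/-- The functor `(X, α) ↦ (X × Z_n, Φ_n(α))`, `f ↦ f × id`. -/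
def EqSch.rho (n : ℕ) (hn : 0 < n) : EqSch k ⥤ EqSch k where
  obj X :=
    { sch := prodZn X.sch n
      isSeparated := inferInstanceAs (IsSeparated ((prodZnFst X.sch n).left ≫ X.sch.hom))
      locallyOfFiniteType :=
        inferInstanceAs (LocallyOfFiniteType ((prodZnFst X.sch n).left ≫ X.sch.hom))
      quasiCompact := inferInstanceAs (QuasiCompact ((prodZnFst X.sch n).left ≫ X.sch.hom))
      action := Phi n hn X.action }
  map f := ⟨prodZnMap f.hom n, ZHatAction.comm_of_one _ _ _ (by
    rw [Phi, Phi, ZHatAction.ofFinOrder_act_one, ZHatAction.ofFinOrder_act_one]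
    exact verschiebung_map n _ _ _ (f.equivariant ZHat.one))⟩
  map_id X := EqSch.Hom.ext (by
    refine copy_hom_ext (fun i => (copyIncl_map _ n i).trans ?_)
    exact (Category.id_comp _).trans (Category.comp_id _).symm)
  map_comp f g := EqSch.Hom.ext (by
    refine copy_hom_ext (fun i => (copyIncl_map _ n i).trans ?_)
    refine Eq.trans ?_ (copyIncl_map_assoc _ n i _).symm
    rw [copyIncl_map, ← Category.assoc]
    rfl)

/-! ### Fibre products -/

namespace EqSch

/-- The endomorphism of a fibre product induced by the action of `z` on the factors. -/
def pbEnd {X Y B : EqSch k} (f : X ⟶ B) (g : Y ⟶ B) (z : ZHat) :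
    pullback f.hom g.hom ⟶ pullback f.hom g.hom :=
  pullback.map _ _ _ _ (X.action.act z).hom (Y.action.act z).hom (B.action.act z).hom
    (f.equivariant z).symm (g.equivariant z).symm

@[simp]
lemma pbEnd_fst {X Y B : EqSch k} (f : X ⟶ B) (g : Y ⟶ B) (z : ZHat) :
    pbEnd f g z ≫ pullback.fst f.hom g.hom = pullback.fst f.hom g.hom ≫ (X.action.act z).hom :=
  pullback.lift_fst _ _ _

lemma pbEnd_fst_assoc {X Y B : EqSch k} (f : X ⟶ B) (g : Y ⟶ B) (z : ZHat)
    {T : Over (Spec (CommRingCat.of k))} (h : X.sch ⟶ T) :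
    pbEnd f g z ≫ pullback.fst f.hom g.hom ≫ h =
      pullback.fst f.hom g.hom ≫ (X.action.act z).hom ≫ h := by
  rw [← Category.assoc, pbEnd_fst, Category.assoc]

@[simp]
lemma pbEnd_snd {X Y B : EqSch k} (f : X ⟶ B) (g : Y ⟶ B) (z : ZHat) :
    pbEnd f g z ≫ pullback.snd f.hom g.hom = pullback.snd f.hom g.hom ≫ (Y.action.act z).hom :=
  pullback.lift_snd _ _ _

lemma pbEnd_snd_assoc {X Y B : EqSch k} (f : X ⟶ B) (g : Y ⟶ B) (z : ZHat)
    {T : Over (Spec (CommRingCat.of k))} (h : Y.sch ⟶ T) :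
    pbEnd f g z ≫ pullback.snd f.hom g.hom ≫ h =
      pullback.snd f.hom g.hom ≫ (Y.action.act z).hom ≫ h := by
  rw [← Category.assoc, pbEnd_snd, Category.assoc]

lemma pbEnd_eq_id {X Y B : EqSch k} (f : X ⟶ B) (g : Y ⟶ B) (z : ZHat)
    (hX : X.action.act z = 1) (hY : Y.action.act z = 1) : pbEnd f g z = 𝟙 _ := by
  apply pullback.hom_ext
  · rw [pbEnd_fst, hX, Category.id_comp]
    exact Category.comp_id _
  · rw [pbEnd_snd, hY, Category.id_comp]
    exact Category.comp_id _

/-- The diagonal action on a fibre product. -/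
def pbAction {X Y B : EqSch k} (f : X ⟶ B) (g : Y ⟶ B) :
    ZHatAction (pullback f.hom g.hom) where
  toHom := (Aut.unitsEndEquivAut _).toMonoidHom.comp (MonoidHom.toHomUnits
    { toFun := fun z => End.of (pbEnd f g z.toAdd)
      map_one' := pbEnd_eq_id f g 0 (map_one X.action.toHom) (map_one Y.action.toHom)
      map_mul' := fun z w => by
        change pbEnd f g (z * w).toAdd = pbEnd f g w.toAdd ≫ pbEnd f g z.toAdd
        have h (T : EqSch k) : (T.action.act (z * w).toAdd).hom =
            (T.action.act w.toAdd).hom ≫ (T.action.act z.toAdd).hom :=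
          congrArg Iso.hom (map_mul T.action.toHom z w)
        apply pullback.hom_ext
        · rw [pbEnd_fst, h, Category.assoc, pbEnd_fst, pbEnd_fst_assoc]
        · rw [pbEnd_snd, h, Category.assoc, pbEnd_snd, pbEnd_snd_assoc] })
  exists_factor := by
    obtain ⟨M, hM⟩ := X.action.exists_act_eq_one
    obtain ⟨N, hN⟩ := Y.action.exists_act_eq_one
    have h1 : ((M : ℕ) ∣ (M * N : ℕ+)) := ⟨N, by simp⟩
    have h2 : ((N : ℕ) ∣ (M * N : ℕ+)) := ⟨M, by simp [mul_comm]⟩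
    refine ZHatAction.exists_factor_of_ker _ (M * N) (fun z hz => Iso.ext ?_)
    exact pbEnd_eq_id f g z (hM z (by rw [← ZHat.castHom_proj h1, hz, map_zero]))
      (hN z (by rw [← ZHat.castHom_proj h2, hz, map_zero]))

lemma left_isPullback {X Y B : Over (Spec (CommRingCat.of k))} (f : X ⟶ B) (g : Y ⟶ B) :
    IsPullback (pullback.fst f g).left (pullback.snd f g).left f.left g.left :=
  (IsPullback.of_hasPullback f g).map (Over.forget _)

/-- The fibre product `X ×_B Y` with the diagonal action. -/
def pb {X Y B : EqSch k} (f : X ⟶ B) (g : Y ⟶ B) : EqSch k :=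
  have h : (pullback.fst f.hom g.hom).left ≫ X.sch.hom = (pullback f.hom g.hom).hom := Over.w _
  have hg : g.hom.left ≫ B.sch.hom = Y.sch.hom := Over.w _
  have _hs : IsSeparated (pullback.fst f.hom g.hom).left :=
    MorphismProperty.of_isPullback (P := @IsSeparated) (left_isPullback f.hom g.hom).flip
      (have : IsSeparated (g.hom.left ≫ B.sch.hom) := hg ▸ Y.isSeparated
       IsSeparated.of_comp _ B.sch.hom)
  have _hl : LocallyOfFiniteType (pullback.fst f.hom g.hom).left :=
    MorphismProperty.of_isPullback (P := @LocallyOfFiniteType) (left_isPullback f.hom g.hom).flip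
      (have : LocallyOfFiniteType (g.hom.left ≫ B.sch.hom) := hg ▸ Y.locallyOfFiniteType
       locallyOfFiniteType_of_comp _ B.sch.hom)
  have _hq : QuasiCompact (pullback.fst f.hom g.hom).left :=
    MorphismProperty.of_isPullback (P := @QuasiCompact) (left_isPullback f.hom g.hom).flip
      (have : QuasiCompact (g.hom.left ≫ B.sch.hom) := hg ▸ Y.quasiCompact
       QuasiCompact.of_comp _ B.sch.hom)
  { sch := pullback f.hom g.hom
    isSeparated := h ▸ inferInstance
    locallyOfFiniteType := h ▸ inferInstance
    quasiCompact := h ▸ inferInstance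
    action := pbAction f g }

/-- The first projection. -/
def pbFst {X Y B : EqSch k} (f : X ⟶ B) (g : Y ⟶ B) : pb f g ⟶ X :=
  ⟨pullback.fst f.hom g.hom, fun z => pbEnd_fst f g z⟩

/-- The second projection. -/
def pbSnd {X Y B : EqSch k} (f : X ⟶ B) (g : Y ⟶ B) : pb f g ⟶ Y :=
  ⟨pullback.snd f.hom g.hom, fun z => pbEnd_snd f g z⟩

/-- A square of equivariant morphisms is a pullback if the square of underlying morphisms is. -/
lemma isPullback_of_hom {P X Y B : EqSch k} {p : P ⟶ X} {q : P ⟶ Y} {f : X ⟶ B} {g : Y ⟶ B}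
    (h : IsPullback p.hom q.hom f.hom g.hom) : IsPullback p q f g := by
  refine ⟨⟨Hom.ext h.w⟩, ⟨PullbackCone.IsLimit.mk _
    (fun s => ⟨h.lift s.fst.hom s.snd.hom (congrArg Hom.hom s.condition), fun z => ?_⟩)
    (fun s => Hom.ext (h.lift_fst _ _ _)) (fun s => Hom.ext (h.lift_snd _ _ _))
    (fun s m h₁ h₂ => Hom.ext (h.hom_ext ?_ ?_))⟩⟩
  · apply h.hom_ext
    · rw [Category.assoc, Category.assoc, h.lift_fst, p.equivariant, h.lift_fst_assoc]
      exact s.fst.equivariant z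
    · rw [Category.assoc, Category.assoc, h.lift_snd, q.equivariant, h.lift_snd_assoc]
      exact s.snd.equivariant z
  · exact (congrArg Hom.hom h₁).trans (h.lift_fst _ _ _).symm
  · exact (congrArg Hom.hom h₂).trans (h.lift_snd _ _ _).symm

lemma pb_isPullback {X Y B : EqSch k} (f : X ⟶ B) (g : Y ⟶ B) :
    IsPullback (pbFst f g) (pbSnd f g) f g :=
  isPullback_of_hom (IsPullback.of_hasPullback f.hom g.hom)

end EqSch

/-- The fibre product of two equivariant `B`-schemes, with the diagonal action. -/
def fibreProd {B : EqSch k} (X Y : Over B) : Over B :=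
  Over.mk (EqSch.pbFst X.hom Y.hom ≫ X.hom)

/-- The first projection. -/
def fpFst {B : EqSch k} (X Y : Over B) : (fibreProd X Y).left ⟶ X.left := EqSch.pbFst X.hom Y.hom

/-- The second projection. -/
def fpSnd {B : EqSch k} (X Y : Over B) : (fibreProd X Y).left ⟶ Y.left := EqSch.pbSnd X.hom Y.hom

lemma fp_isPullback {B : EqSch k} (X Y : Over B) :
    IsPullback (fpFst X Y) (fpSnd X Y) X.hom Y.hom :=
  EqSch.pb_isPullback X.hom Y.hom

lemma fp_schHom_isPullback {B : EqSch k} (X Y : Over B) :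
    IsPullback (EqSch.schHom (fpFst X Y)) (EqSch.schHom (fpSnd X Y)) (EqSch.schHom X.hom)
      (EqSch.schHom Y.hom) :=
  EqSch.left_isPullback X.hom.hom Y.hom.hom

lemma fp_hom_fst {B : EqSch k} (X Y : Over B) : (fibreProd X Y).hom = fpFst X Y ≫ X.hom := rfl

lemma fp_hom_snd {B : EqSch k} (X Y : Over B) : (fibreProd X Y).hom = fpSnd X Y ≫ Y.hom :=
  (fp_isPullback X Y).w

lemma EqSch.schHom_comp {X Y Z : EqSch k} (f : X ⟶ Y) (g : Y ⟶ Z) :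
    schHom (f ≫ g) = schHom f ≫ schHom g := rfl

/-- The morphism `X ×_B Z → X ×_B Y` induced by `Z → Y`. -/
def fibreProdMap {B : EqSch k} (X : Over B) {Y Z : Over B} (h : Z ⟶ Y) :
    fibreProd X Z ⟶ fibreProd X Y :=
  Over.homMk ((fp_isPullback X Y).lift (fpFst X Z) (fpSnd X Z ≫ h.left)
    (by rw [Category.assoc, Over.w, (fp_isPullback X Z).w])) (by
    rw [fp_hom_fst, fp_hom_fst, (fp_isPullback X Y).lift_fst_assoc])

lemma fibreProdMap_isPullback {B : EqSch k} (X : Over B) {Y Z : Over B} (h : Z ⟶ Y) :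
    IsPullback (EqSch.schHom (fibreProdMap X h).left) (EqSch.schHom (fpSnd X Z))
      (EqSch.schHom (fpSnd X Y)) (EqSch.schHom h.left) := by
  refine IsPullback.of_right ?_ ?_ (fp_schHom_isPullback X Y)
  · rw [← EqSch.schHom_comp, ← EqSch.schHom_comp, Over.w]
    have h1 : (fibreProdMap X h).left ≫ fpFst X Y = fpFst X Z :=
      (fp_isPullback X Y).lift_fst _ _ _
    rw [h1]
    exact fp_schHom_isPullback X Z
  · exact congrArg EqSch.schHom ((fp_isPullback X Y).lift_snd _ _ _)

lemma range_fibreProdMap {B : EqSch k} (X : Over B) {Y Z : Over B} (h : Z ⟶ Y) :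
    Set.range (EqSch.schHom (fibreProdMap X h).left) =
      EqSch.schHom (fpSnd X Y) ⁻¹' Set.range (EqSch.schHom h.left) := by
  have := Scheme.image_preimage_eq_of_isPullback (fibreProdMap_isPullback X h).flip Set.univ
  rw [Set.preimage_univ, Set.image_univ, Set.image_univ] at this
  exact this

/-- A pullback square over `B` identifies its corner with the fibre product. -/
def fibreProdIso {B : EqSch k} {X Y P : Over B} {p : P.left ⟶ X.left} {q : P.left ⟶ Y.left}
    (h : IsPullback p q X.hom Y.hom) (hp : p ≫ X.hom = P.hom) : fibreProd X Y ≅ P :=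
  Over.isoMk ((fp_isPullback X Y).isoIsPullback _ _ h) (by
    rw [← hp, IsPullback.isoIsPullback_hom_fst_assoc]
    rfl)

/-- The fibre product over `B` is commutative. -/
def fibreProdComm {B : EqSch k} (X Y : Over B) : fibreProd X Y ≅ fibreProd Y X :=
  fibreProdIso (fp_isPullback Y X).flip (fp_hom_snd Y X).symm

/-- `B` is a unit for the fibre product over `B`. -/
def fibreProdOne {B : EqSch k} (X : Over B) : fibreProd X (Over.mk (𝟙 B)) ≅ X :=
  fibreProdIso (p := 𝟙 _) (q := X.hom) (IsPullback.id_horiz X.hom).flip.flip (Category.id_comp _)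

/-- The fibre product over `B` is associative. -/
def fibreProdAssoc {B : EqSch k} (X Y Z : Over B) :
    fibreProd (fibreProd X Y) Z ≅ fibreProd X (fibreProd Y Z) :=
  let p : (fibreProd X (fibreProd Y Z)).left ⟶ (fibreProd X Y).left :=
    (fp_isPullback X Y).lift (fpFst X (fibreProd Y Z)) (fpSnd X (fibreProd Y Z) ≫ fpFst Y Z)
      (by rw [(fp_isPullback X (fibreProd Y Z)).w, fp_hom_fst, Category.assoc])
  have hp : p ≫ fpFst X Y = fpFst X (fibreProd Y Z) := (fp_isPullback X Y).lift_fst _ _ _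
  have h1 : IsPullback p (fpSnd X (fibreProd Y Z)) (fpSnd X Y) (fpFst Y Z) :=
    IsPullback.of_right (by rw [hp, ← fp_hom_fst]; exact fp_isPullback X (fibreProd Y Z))
      ((fp_isPullback X Y).lift_snd _ _ _) (fp_isPullback X Y)
  fibreProdIso (p := p) (q := fpSnd X (fibreProd Y Z) ≫ fpSnd Y Z)
    (by rw [fp_hom_snd]; exact (h1.flip.paste_horiz (fp_isPullback Y Z).flip).flip)
    (by rw [fp_hom_fst, ← Category.assoc, hp]; rfl)

/-! ### Equivariant decompositions -/

/-- As a set, `X` is the disjoint union of the images of `i` and `j`. -/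
def IsPartition {X Y Z : EqSch k} (i : Y ⟶ X) (j : Z ⟶ X) : Prop :=
  IsCompl (Set.range (EqSch.schHom i)) (Set.range (EqSch.schHom j))

/-- The properties of an endofunctor of the category of schemes with action that make it act on
Grothendieck groups and on Burnside groups. -/
structure IsGeometric (F : EqSch k ⥤ EqSch k) : Prop where
  closedImmersion : ∀ {X Y : EqSch k} (f : X ⟶ Y), IsClosedImmersion (EqSch.schHom f) →
    IsClosedImmersion (EqSch.schHom (F.map f))
  openImmersion : ∀ {X Y : EqSch k} (f : X ⟶ Y), IsOpenImmersion (EqSch.schHom f) →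
    IsOpenImmersion (EqSch.schHom (F.map f))
  denseRange : ∀ {X Y : EqSch k} (f : X ⟶ Y), DenseRange (EqSch.schHom f) →
    DenseRange (EqSch.schHom (F.map f))
  partition : ∀ {X Y Z : EqSch k} (i : Y ⟶ X) (j : Z ⟶ X), IsPartition i j →
    IsPartition (F.map i) (F.map j)
  smooth : ∀ X : EqSch k, Smooth X.sch.hom → Smooth (F.obj X).sch.hom

lemma isGeometric_sigma (n : ℕ) : IsGeometric (EqSch.sigma (k := k) n) where
  closedImmersion _ h := h
  openImmersion _ h := h
  denseRange _ h := h
  partition _ _ h := h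
  smooth _ h := h

lemma range_rho_map (n : ℕ) (hn : 0 < n) {X Y : EqSch k} (f : X ⟶ Y) :
    Set.range (EqSch.schHom ((EqSch.rho n hn).map f)) =
      (prodZnFst Y.sch n).left ⁻¹' Set.range (EqSch.schHom f) := by
  have := Scheme.image_preimage_eq_of_isPullback (prodZnMap_isPullback f.hom n).flip Set.univ
  rw [Set.preimage_univ, Set.image_univ, Set.image_univ] at this
  exact this

lemma isGeometric_rho (n : ℕ) (hn : 0 < n) : IsGeometric (EqSch.rho (k := k) n hn) where
  closedImmersion f h :=
    MorphismProperty.of_isPullback (P := @IsClosedImmersion) (prodZnMap_isPullback f.hom n).flip h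
  openImmersion f h :=
    MorphismProperty.of_isPullback (P := @IsOpenImmersion) (prodZnMap_isPullback f.hom n).flip h
  denseRange {X Y} f h := by
    rw [DenseRange, range_rho_map]
    exact h.preimage (prodZnFst Y.sch n).left.isOpenMap
  partition i j h := by
    rw [IsPartition, range_rho_map, range_rho_map]
    exact h.preimage _
  smooth X h := inferInstanceAs (Smooth ((prodZnFst X.sch n).left ≫ X.sch.hom))

/-! ### The equivariant Grothendieck ring -/

/-- The scissor relations `[X] = [Y] + [U]` over `B`, for `Y → X` a closed equivariant embedding
and `U → X` its open complement. (With `U` empty they contain the relations `[X] = [Y]` for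
isomorphic `X` and `Y`.) -/
def scissorRel (B : EqSch k) : Set (FreeAbelianGroup (Over B)) :=
  {r | ∃ (X Y U : Over B) (i : Y ⟶ X) (j : U ⟶ X),
    IsClosedImmersion (EqSch.schHom i.left) ∧ IsOpenImmersion (EqSch.schHom j.left) ∧
    IsPartition i.left j.left ∧
    r = FreeAbelianGroup.of X - FreeAbelianGroup.of Y - FreeAbelianGroup.of U}

/-- The relative equivariant Grothendieck ring `K_0^Ẑ(B, α_B)` (for its product see below). -/
def K0 (B : EqSch k) : Type (u + 1) :=
  FreeAbelianGroup (Over B) ⧸ AddSubgroup.closure (scissorRel B)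

instance (B : EqSch k) : AddCommGroup (K0 B) :=
  inferInstanceAs (AddCommGroup (FreeAbelianGroup (Over B) ⧸ AddSubgroup.closure (scissorRel B)))

/-- The class `[X → B]` in `K_0^Ẑ(B, α_B)`. -/
def K0.mk {B : EqSch k} (X : Over B) : K0 B :=
  QuotientAddGroup.mk (FreeAbelianGroup.of X)

/-- The empty scheme over `B`. -/
def emptyOver (B : EqSch k) : Over B :=
  Over.mk (Y := (⟨Over.mk (Scheme.emptyTo (Spec (CommRingCat.of k))), 
    inferInstanceAs (IsSeparated (Scheme.emptyTo _)),
    inferInstanceAs (LocallyOfFiniteType (Scheme.emptyTo _)),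
    inferInstanceAs (QuasiCompact (Scheme.emptyTo _)), ⟨1, 1, 1, fun _ => rfl⟩⟩ : EqSch k))
    ⟨Over.homMk (Scheme.emptyTo _) (Scheme.empty_ext _ _),
      fun _ => Over.OverMorphism.ext (Scheme.empty_ext _ _)⟩

lemma K0.mk_eq_add {B : EqSch k} {X Y U : Over B} (i : Y ⟶ X) (j : U ⟶ X)
    (hi : IsClosedImmersion (EqSch.schHom i.left)) (hj : IsOpenImmersion (EqSch.schHom j.left))
    (hij : IsPartition i.left j.left) : K0.mk X = K0.mk Y + K0.mk U := by
  have : (QuotientAddGroup.mk (FreeAbelianGroup.of X - FreeAbelianGroup.of Y -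
      FreeAbelianGroup.of U) : K0 B) = 0 :=
    (QuotientAddGroup.eq_zero_iff _).2
      (AddSubgroup.subset_closure ⟨X, Y, U, i, j, hi, hj, hij, rfl⟩)
  have h : K0.mk X - K0.mk Y - K0.mk U = 0 := this
  rwa [sub_sub, sub_eq_zero] at h

lemma K0.mk_eq_of_iso {B : EqSch k} {X Y : Over B} (e : X ≅ Y) : K0.mk X = K0.mk Y := by
  have key (X Y : Over B) (e : Y ≅ X) : K0.mk X = K0.mk Y + K0.mk (emptyOver B) := by
    have h1 : IsIso (EqSch.schHom e.hom.left) :=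
      ⟨EqSch.schHom e.inv.left, congrArg (fun f : Y ⟶ Y => EqSch.schHom f.left) e.hom_inv_id,
        congrArg (fun f : X ⟶ X => EqSch.schHom f.left) e.inv_hom_id⟩
    let j : emptyOver B ⟶ X := Over.homMk
      ⟨Over.homMk (Scheme.emptyTo _) (Scheme.empty_ext _ _),
        fun _ => Over.OverMorphism.ext (Scheme.empty_ext _ _)⟩
      (EqSch.Hom.ext (Over.OverMorphism.ext (Scheme.empty_ext _ _)))
    refine K0.mk_eq_add e.hom j inferInstance
      (inferInstanceAs (IsOpenImmersion (Scheme.emptyTo _))) ?_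
    have h2 : Set.range (EqSch.schHom j.left) = ∅ :=
      Set.range_eq_empty (ι := (∅ : Scheme.{u})) _
    have h3 : Set.range (EqSch.schHom e.hom.left) = Set.univ :=
      (EqSch.schHom e.hom.left).homeomorph.surjective.range_eq
    rw [IsPartition, h2, h3]
    exact isCompl_top_bot
  have h0 := key _ _ (Iso.refl (emptyOver B))
  rw [left_eq_add] at h0
  have := key Y X e
  rwa [h0, add_zero, eq_comm] at this

lemma K0.hom_ext {B : EqSch k} {A : Type*} [AddCommGroup A] {f g : K0 B →+ A}
    (h : ∀ X : Over B, f (K0.mk X) = g (K0.mk X)) : f = g :=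
  QuotientAddGroup.addMonoidHom_ext _ (FreeAbelianGroup.lift_ext _ _ h)

/-- A function on equivariant `B`-schemes that satisfies the scissor relations extends to
`K_0^Ẑ(B, α_B)`. -/
def K0.lift {B : EqSch k} {A : Type*} [AddCommGroup A] (f : Over B → A)
    (hf : ∀ (X Y U : Over B) (i : Y ⟶ X) (j : U ⟶ X), IsClosedImmersion (EqSch.schHom i.left) →
      IsOpenImmersion (EqSch.schHom j.left) → IsPartition i.left j.left → f X = f Y + f U) :
    K0 B →+ A :=
  QuotientAddGroup.lift _ (FreeAbelianGroup.lift f) (by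
    rw [AddSubgroup.closure_le]
    rintro _ ⟨X, Y, U, i, j, hi, hj, hij, rfl⟩
    simp [hf X Y U i j hi hj hij])

@[simp] lemma K0.lift_mk {B : EqSch k} {A : Type*} [AddCommGroup A] (f : Over B → A) (hf)
    (X : Over B) : K0.lift f hf (K0.mk X) = f X :=
  FreeAbelianGroup.lift_apply_of _ _

lemma K0.mk_fibreProd {B : EqSch k} (T X Y U : Over B) (i : Y ⟶ X) (j : U ⟶ X)
    (hi : IsClosedImmersion (EqSch.schHom i.left)) (hj : IsOpenImmersion (EqSch.schHom j.left))
    (hij : IsPartition i.left j.left) :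
    K0.mk (fibreProd T X) = K0.mk (fibreProd T Y) + K0.mk (fibreProd T U) := by
  refine K0.mk_eq_add (fibreProdMap T i) (fibreProdMap T j)
    (MorphismProperty.of_isPullback (P := @IsClosedImmersion) (fibreProdMap_isPullback T i).flip hi)
    (MorphismProperty.of_isPullback (P := @IsOpenImmersion) (fibreProdMap_isPullback T j).flip hj)
    ?_
  rw [IsPartition, range_fibreProdMap, range_fibreProdMap]
  exact hij.preimage _

/-- The product of `K_0^Ẑ(B, α_B)`, with `[X → B] · [Y → B] = [X ×_B Y → B]`. -/
def K0.mulHom (B : EqSch k) : K0 B →+ K0 B →+ K0 B :=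
  K0.lift (fun X => K0.lift (fun Y => K0.mk (fibreProd X Y)) (K0.mk_fibreProd X))
    (fun X Y U i j hi hj hij => K0.hom_ext (fun T => by
      rw [AddMonoidHom.add_apply, K0.lift_mk, K0.lift_mk, K0.lift_mk,
        K0.mk_eq_of_iso (fibreProdComm X T), K0.mk_eq_of_iso (fibreProdComm Y T),
        K0.mk_eq_of_iso (fibreProdComm U T), K0.mk_fibreProd T X Y U i j hi hj hij]))

@[simp] lemma K0.mulHom_mk {B : EqSch k} (X Y : Over B) :
    K0.mulHom B (K0.mk X) (K0.mk Y) = K0.mk (fibreProd X Y) := by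
  rw [K0.mulHom, K0.lift_mk, K0.lift_mk]

lemma K0.mul_comm' {B : EqSch k} (x y : K0 B) : K0.mulHom B x y = K0.mulHom B y x := by
  have : K0.mulHom B = (K0.mulHom B).flip := K0.hom_ext fun X => K0.hom_ext fun Y => by
    rw [AddMonoidHom.flip_apply, K0.mulHom_mk, K0.mulHom_mk]
    exact K0.mk_eq_of_iso (fibreProdComm X Y)
  exact DFunLike.congr_fun (DFunLike.congr_fun this x) y

lemma K0.mul_one' {B : EqSch k} (x : K0 B) : K0.mulHom B x (K0.mk (Over.mk (𝟙 B))) = x := by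
  have : (K0.mulHom B).flip (K0.mk (Over.mk (𝟙 B))) = AddMonoidHom.id _ :=
    K0.hom_ext fun X => by
      rw [AddMonoidHom.flip_apply, K0.mulHom_mk]
      exact K0.mk_eq_of_iso (fibreProdOne X)
  exact DFunLike.congr_fun this x

lemma K0.mul_assoc' {B : EqSch k} (x y z : K0 B) :
    K0.mulHom B (K0.mulHom B x y) z = K0.mulHom B x (K0.mulHom B y z) := by
  have h1 (X Y : Over B) (z : K0 B) : K0.mulHom B (K0.mulHom B (K0.mk X) (K0.mk Y)) z =
      K0.mulHom B (K0.mk X) (K0.mulHom B (K0.mk Y) z) := by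
    have : K0.mulHom B (K0.mulHom B (K0.mk X) (K0.mk Y)) =
        (K0.mulHom B (K0.mk X)).comp (K0.mulHom B (K0.mk Y)) := K0.hom_ext fun Z => by
      simp only [AddMonoidHom.comp_apply, K0.mulHom_mk]
      exact K0.mk_eq_of_iso (fibreProdAssoc X Y Z)
    exact DFunLike.congr_fun this z
  have h2 (X : Over B) (y z : K0 B) : K0.mulHom B (K0.mulHom B (K0.mk X) y) z =
      K0.mulHom B (K0.mk X) (K0.mulHom B y z) := by
    have : ((K0.mulHom B).flip z).comp (K0.mulHom B (K0.mk X)) =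
        (K0.mulHom B (K0.mk X)).comp ((K0.mulHom B).flip z) := K0.hom_ext fun Y => h1 X Y z
    exact DFunLike.congr_fun this y
  have : ((K0.mulHom B).flip z).comp ((K0.mulHom B).flip y) =
      (K0.mulHom B).flip (K0.mulHom B y z) := K0.hom_ext fun X => h2 X y z
  exact DFunLike.congr_fun this x

/-- The relative equivariant Grothendieck ring `K_0^Ẑ(B, α_B)`: the product is the fibre product
over `B` with the diagonal action. -/
instance (B : EqSch k) : CommRing (K0 B) :=
  { (inferInstance : AddCommGroup (K0 B)) with
    mul := fun x y => K0.mulHom B x y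
    one := K0.mk (Over.mk (𝟙 B))
    mul_assoc := K0.mul_assoc'
    mul_comm := K0.mul_comm'
    one_mul := fun x => (K0.mul_comm' _ _).trans (K0.mul_one' x)
    mul_one := K0.mul_one'
    left_distrib := fun x y z => map_add (K0.mulHom B x) y z
    right_distrib := fun x y z => DFunLike.congr_fun (map_add (K0.mulHom B) x y) z
    zero_mul := fun x => DFunLike.congr_fun (map_zero (K0.mulHom B)) x
    mul_zero := fun x => map_zero (K0.mulHom B x) }

/-- The additive map on Grothendieck rings induced by `F`, with
`[f : X → B] ↦ [F(f) : F(X) → F(B)]`. -/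
def K0.map {F : EqSch k ⥤ EqSch k} (hF : IsGeometric F) (B : EqSch k) : K0 B →+ K0 (F.obj B) :=
  K0.lift (fun X => K0.mk ((Over.post F).obj X)) fun _ _ _ i j hi hj hij =>
    K0.mk_eq_add ((Over.post F).map i) ((Over.post F).map j) (hF.closedImmersion _ hi)
      (hF.openImmersion _ hj) (hF.partition _ _ hij)

/-- `σ_n : K_0^Ẑ(B, α_B) → K_0^Ẑ(B, α_B ∘ σ_n)`, a ring homomorphism. -/
def K0.sigma (n : ℕ) (B : EqSch k) : K0 B →+* K0 ((EqSch.sigma n).obj B) :=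
  { K0.map (isGeometric_sigma n) B with
    map_one' := K0.lift_mk _ _ _
    map_mul' := by
      have h (X Y : Over B) : K0.mk ((Over.post (EqSch.sigma n)).obj (fibreProd X Y)) =
          K0.mk (fibreProd ((Over.post (EqSch.sigma n)).obj X)
            ((Over.post (EqSch.sigma n)).obj Y)) := by
        refine (K0.mk_eq_of_iso (fibreProdIso (p := (EqSch.sigma n).map (fpFst X Y))
          (q := (EqSch.sigma n).map (fpSnd X Y)) ?_ ?_)).symm
        · exact EqSch.isPullback_of_hom (IsPullback.of_hasPullback X.hom.hom Y.hom.hom)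
        · exact ((EqSch.sigma n).map_comp _ _).symm
      have : (AddMonoidHom.mul.compr₂ (K0.map (isGeometric_sigma n) B)) =
          (AddMonoidHom.mul.compl₂ (K0.map (isGeometric_sigma n) B)).comp
            (K0.map (isGeometric_sigma n) B) :=
        K0.hom_ext fun X => K0.hom_ext fun Y => by
          change K0.map (isGeometric_sigma n) B (K0.mulHom B (K0.mk X) (K0.mk Y)) =
            K0.mulHom _ (K0.map (isGeometric_sigma n) B (K0.mk X))
              (K0.map (isGeometric_sigma n) B (K0.mk Y))
          rw [K0.mulHom_mk, K0.map, K0.lift_mk, K0.lift_mk, K0.lift_mk, K0.mulHom_mk]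
          exact h X Y
      exact fun x y => DFunLike.congr_fun (DFunLike.congr_fun this x) y }

/-- `ρ̃_n : K_0^Ẑ(B, α_B) → K_0^Ẑ(B × Z_n, Φ_n(α_B))`. -/
def K0.rho (n : ℕ) (hn : 0 < n) (B : EqSch k) : K0 B →+ K0 ((EqSch.rho n hn).obj B) :=
  K0.map (isGeometric_rho n hn) B

/-! ### The equivariant Burnside group -/

/-- Smooth equivariant `B`-schemes: equivariant morphisms `X → B` with `X` smooth over `k` (the
morphism to `B` need not be smooth). -/
def SmoothOver (B : EqSch k) : Type (u + 1) := {X : Over B // Smooth X.left.sch.hom}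

/-- The relations of the Burnside group: `[X] = [U]` for `U → X` an equivariant dense open
embedding over `B`, and `[X] = [Y] + [Z]` when `X` is the disjoint union of `Y` and `Z`. -/
def burnRel (B : EqSch k) : Set (FreeAbelianGroup (SmoothOver B)) :=
  {r | ∃ (X U : SmoothOver B) (j : U.1 ⟶ X.1),
    IsOpenImmersion (EqSch.schHom j.left) ∧ DenseRange (EqSch.schHom j.left) ∧
    r = FreeAbelianGroup.of X - FreeAbelianGroup.of U} ∪
  {r | ∃ (X Y Z : SmoothOver B) (i : Y.1 ⟶ X.1) (j : Z.1 ⟶ X.1),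
    IsOpenImmersion (EqSch.schHom i.left) ∧ IsOpenImmersion (EqSch.schHom j.left) ∧
    IsPartition i.left j.left ∧
    r = FreeAbelianGroup.of X - FreeAbelianGroup.of Y - FreeAbelianGroup.of Z}

/-- The equivariant Burnside group `Burn^Ẑ(B, α_B)`. -/
def Burn (B : EqSch k) : Type (u + 1) :=
  FreeAbelianGroup (SmoothOver B) ⧸ AddSubgroup.closure (burnRel B)

instance (B : EqSch k) : AddCommGroup (Burn B) :=
  inferInstanceAs
    (AddCommGroup (FreeAbelianGroup (SmoothOver B) ⧸ AddSubgroup.closure (burnRel B)))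

/-- The class `[X → B]` in `Burn^Ẑ(B, α_B)`. -/
def Burn.mk {B : EqSch k} (X : SmoothOver B) : Burn B :=
  QuotientAddGroup.mk (FreeAbelianGroup.of X)

/-- The map on smooth `B`-schemes induced by `F`. -/
def SmoothOver.map {F : EqSch k ⥤ EqSch k} (hF : IsGeometric F) {B : EqSch k} (X : SmoothOver B) :
    SmoothOver (F.obj B) :=
  ⟨(Over.post F).obj X.1, hF.smooth _ X.2⟩

/-- The additive map on Burnside groups induced by `F`, with
`[f : X → B] ↦ [F(f) : F(X) → F(B)]`. -/
def Burn.map {F : EqSch k ⥤ EqSch k} (hF : IsGeometric F) (B : EqSch k) :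
    Burn B →+ Burn (F.obj B) :=
  QuotientAddGroup.map _ _ (FreeAbelianGroup.map (SmoothOver.map hF)) (by
    rw [AddSubgroup.closure_le]
    rintro _ (⟨X, U, j, hj, hd, rfl⟩ | ⟨X, Y, Z, i, j, hi, hj, hij, rfl⟩)
    · refine AddSubgroup.subset_closure (Or.inl ⟨SmoothOver.map hF X, SmoothOver.map hF U,
        (Over.post F).map j, hF.openImmersion _ hj, hF.denseRange _ hd, ?_⟩)
      simp
    · refine AddSubgroup.subset_closure (Or.inr ⟨SmoothOver.map hF X, SmoothOver.map hF Y,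
        SmoothOver.map hF Z, (Over.post F).map i, (Over.post F).map j, hF.openImmersion _ hi,
        hF.openImmersion _ hj, hF.partition _ _ hij, ?_⟩)
      simp)

/-- `σ_n : Burn^Ẑ(B, α_B) → Burn^Ẑ(B, α_B ∘ σ_n)`. -/
def Burn.sigma (n : ℕ) (B : EqSch k) : Burn B →+ Burn ((EqSch.sigma n).obj B) :=
  Burn.map (isGeometric_sigma n) B

/-- `ρ̃_n : Burn^Ẑ(B, α_B) → Burn^Ẑ(B × Z_n, Φ_n(α_B))`. -/
def Burn.rho (n : ℕ) (hn : 0 < n) (B : EqSch k) : Burn B →+ Burn ((EqSch.rho n hn).obj B) :=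
  Burn.map (isGeometric_rho n hn) B

/-! ### The filtration by dimension and the associated graded group -/

/-- The dimension of a `B`-scheme `X → B`, i.e. the Krull dimension of `X`. -/
def dim {B : EqSch k} (X : Over B) : WithBot ℕ∞ := topologicalKrullDim X.left.sch.left

/-- The step `F_d` of the filtration of `K_0^Ẑ(B, α_B)` by dimension: it is generated by the
classes `[X → B]` with `dim X ≤ d`. -/
def K0.fil (B : EqSch k) (d : ℕ) : AddSubgroup (K0 B) :=
  AddSubgroup.closure {x | ∃ X : Over B, dim X ≤ d ∧ x = K0.mk X}

/-- The step `F_{d-1}` of the filtration of `K_0^Ẑ(B, α_B)` by dimension: it is generated by the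
classes `[X → B]` with `dim X < d` (so it is `0` for `d = 0`). -/
def K0.filLT (B : EqSch k) (d : ℕ) : AddSubgroup (K0 B) :=
  AddSubgroup.closure {x | ∃ X : Over B, dim X < d ∧ x = K0.mk X}

/-- The associated graded group `gr K_0^Ẑ(B, α_B) = ⨁_d F_d / F_{d-1}`. -/
abbrev GrK0 (B : EqSch k) : Type (u + 1) :=
  DirectSum ℕ fun d => K0.fil B d ⧸ (K0.filLT B d).addSubgroupOf (K0.fil B d)

/-- The homogeneous element of degree `d` of `gr K_0^Ẑ(B, α_B)` defined by the class of `X → B`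
with `dim X ≤ d`. -/
def GrK0.mk {B : EqSch k} (d : ℕ) (X : Over B) (h : dim X ≤ d) : GrK0 B :=
  DirectSum.of (fun d => K0.fil B d ⧸ (K0.filLT B d).addSubgroupOf (K0.fil B d)) d
    (QuotientAddGroup.mk ⟨K0.mk X, AddSubgroup.subset_closure ⟨X, h, rfl⟩⟩)

/-- An additive map between Grothendieck groups preserves the filtrations by dimension. -/
def PreservesFil {B B' : EqSch k} (φ : K0 B →+ K0 B') : Prop :=
  ∀ d, (∀ x ∈ K0.fil B d, φ x ∈ K0.fil B' d) ∧ ∀ x ∈ K0.filLT B d, φ x ∈ K0.filLT B' d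

/-- The map on associated graded groups induced by a map that preserves the filtrations. -/
def GrK0.map {B B' : EqSch k} (φ : K0 B →+ K0 B') (h : PreservesFil φ) : GrK0 B →+ GrK0 B' :=
  DirectSum.map fun d => QuotientAddGroup.map _ _
    ((φ.comp (K0.fil B d).subtype).codRestrict (K0.fil B' d) fun x => (h d).1 x x.2)
    fun x hx => (h d).2 x hx

/-- `Ψ` is the morphism `Burn^Ẑ(B, α_B) → gr K_0^Ẑ(B, α_B)`: it takes the class of a smooth
`B`-scheme `X → B` of pure dimension `d` to the class of `X → B` in `F_d / F_{d-1}`. (A scheme that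
is smooth over the field `k` is of pure dimension `d` iff it is smooth of relative dimension `d`
over `k`.) -/
def IsClassMap {B : EqSch k} (Ψ : Burn B →+ GrK0 B) : Prop :=
  ∀ (d : ℕ) (X : SmoothOver B), SmoothOfRelativeDimension d X.1.left.sch.hom →
    ∃ h : dim X.1 ≤ d, Ψ (Burn.mk X) = GrK0.mk d X.1 h

end BostConnes

end

/-! A smooth `k`-scheme `X` is the disjoint union of the open and closed loci `X_d` where it is
smooth of relative dimension `d`. Automorphisms of `X` preserve these loci, and by quasi-compactness
only finitely many are non-empty. The map is forced to be `Ψ[X] = ∑ [X_d]`, with `[X_d]` taken in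
`F_d / F_{d-1}`. This makes sense because `X_d` is locally étale over an affine space of dimension
`d`, so that `dim X_d ≤ d` (`topologicalKrullDim_le_of_smoothOfRelativeDimension`).

Ψ respects the relations of the Burnside group. If `U ⊂ X` is dense open, then `U_d = U ∩ X_d` is
dense in `X_d`. Its complement is closed and nowhere dense, hence of dimension `< d`, and its class
dies in `F_d / F_{d-1}` (`componentClass_eq_of_dense`). For a disjoint union the scissor relation
applies in each degree (`componentClass_eq_add`).

Uniqueness: in the Burnside group `[X]` is already the finite sum of the `[X_d]`, so a homomorphism
is determined by its values on schemes of pure dimension (`Burn.hom_ext_of_pure`). The same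
principle gives the compatibilities. On a pure-dimensional `X` both composites produce the class of
the transformed scheme in degree `d`, provided that the functor preserves relative dimension. The
functor for `σ_n` does not touch the scheme. The one for `ρ̃_n` replaces `X` by `n` open copies of
itself, étale over `X`. -/

noncomputable section

namespace BostConnes

/-! ### Krull dimension -/

/-- A bound for the Krull dimension of a space may be checked on open charts. -/
lemma topologicalKrullDim_le_of_forall_exists_isOpenEmbedding {X : Type u} [TopologicalSpace X]
    (d : WithBot ℕ∞) (h : ∀ x : X, ∃ (Y : Type u) (_ : TopologicalSpace Y) (f : Y → X),
      Topology.IsOpenEmbedding f ∧ x ∈ Set.range f ∧ topologicalKrullDim Y ≤ d) :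
    topologicalKrullDim X ≤ d := by
  -- Coheight rather than height: the members of a chain that starts at `Z` all contain the point
  -- `z`, so all of them meet a chart around `z` and are determined by their traces on it. A chain
  -- below `Z` could leave the chart.
  rw [topologicalKrullDim, Order.krullDim_eq_iSup_coheight]
  refine iSup_le fun Z => ?_
  obtain ⟨z, hz⟩ := Z.2.nonempty
  obtain ⟨Y, _, f, hf, ⟨y, rfl⟩, hd⟩ := h z
  have e := (TopologicalSpace.IrreducibleCloseds.orderIsoOfIsOpenEmbedding f hf).right_inv
    ⟨Z, y, hz⟩
  have e' := congrArg Subtype.val e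
  change TopologicalSpace.IrreducibleCloseds.map f hf.continuous _ = Z at e'
  rw [← e', hf.coheight_map]
  exact (Order.coheight_le_krullDim _).trans hd

/-- In a Noetherian space no irreducible component lies in a set with dense complement. -/
lemma not_subset_of_mem_irreducibleComponents {X : Type*} [TopologicalSpace X]
    [TopologicalSpace.NoetherianSpace X] {Z C : Set X} (hd : Dense Zᶜ)
    (hC : C ∈ irreducibleComponents X) : ¬ C ⊆ Z := by
  intro h
  -- A Noetherian space has finitely many components, so each of them contains a non-empty open set,
  -- and a dense set must meet it.
  obtain ⟨U, hU, hne, hUC⟩ :=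
    TopologicalSpace.NoetherianSpace.exists_isOpen_nonempty_subset_irreducibleComponent C hC
  obtain ⟨x, hx, hx'⟩ := hd.inter_open_nonempty U hU hne
  exact hx' (h (hUC hx))

/-- The dimension drops when passing to a nowhere dense closed subspace. -/
lemma topologicalKrullDim_lt_of_isClosedEmbedding {X Z : Type*} [TopologicalSpace X]
    [TopologicalSpace Z] [TopologicalSpace.NoetherianSpace X] {f : Z → X}
    (hf : Topology.IsClosedEmbedding f) (hd : Dense (Set.range f)ᶜ) {d : ℕ}
    (h : topologicalKrullDim X ≤ d) : topologicalKrullDim Z < d := by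
  by_contra! hlt
  obtain ⟨l, hl⟩ := Order.le_krullDim_iff.1 hlt
  -- A chain of length `d` in `Z`, pushed to `X` by taking closures of images. Its last member lies
  -- in the closed set `range f` but in no case fills a component `C` of `X`, so `C` can be appended
  -- and gives a chain of length `d + 1`.
  let p : LTSeries (TopologicalSpace.IrreducibleCloseds X) :=
    l.map _ (TopologicalSpace.IrreducibleCloseds.map_strictMono_of_isInducing hf.isInducing)
  obtain ⟨C, hC, hpC⟩ := exists_mem_irreducibleComponents_subset_of_isIrreducible _ p.last.2
  have hlast : (p.last : Set X) ⊆ Set.range f := by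
    have : p.last = TopologicalSpace.IrreducibleCloseds.map f hf.continuous l.last := rfl
    rw [this]
    exact closure_minimal (Set.image_subset_range _ _) hf.isClosed_range
  let C' : TopologicalSpace.IrreducibleCloseds X :=
    ⟨C, hC.1, isClosed_of_mem_irreducibleComponents C hC⟩
  have hlt' : p.last < C' := lt_of_le_of_ne hpC fun e =>
    not_subset_of_mem_irreducibleComponents hd hC
      ((congrArg (fun W : TopologicalSpace.IrreducibleCloseds X => (W : Set X)) e).symm.trans_le
        hlast)
  have := (Order.LTSeries.length_le_krullDim (p.snoc C' hlt')).trans h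
  have hp : p.length = d := hl
  rw [RelSeries.snoc_length, hp] at this
  norm_cast at this
  omega

/-- A quasi-finite algebra has at most the dimension of the base. -/
lemma ringKrullDim_le_of_quasiFinite (R S : Type*) [CommRing R] [CommRing S] [Algebra R S]
    [Algebra.QuasiFinite R S] : ringKrullDim S ≤ ringKrullDim R := by
  -- Comparable primes of `S` with the same contraction to `R` coincide, so contraction carries
  -- strict chains to strict chains.
  refine Order.krullDim_le_of_strictMono (PrimeSpectrum.comap (algebraMap R S)) fun P Q h => ?_
  refine lt_of_le_of_ne (Ideal.comap_mono h.le) fun e => h.ne ?_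
  exact PrimeSpectrum.ext (Algebra.QuasiFinite.eq_of_le_of_under_eq (R := R) P.asIdeal Q.asIdeal
    h.le (congrArg PrimeSpectrum.asIdeal e))

/-- A standard smooth algebra of relative dimension `n` over a Noetherian ring of dimension `0` has
dimension at most `n`. -/
lemma ringKrullDim_le_of_isStandardSmoothOfRelativeDimension {R S : Type*} [CommRing R]
    [CommRing S] [IsNoetherianRing R] (hR : ringKrullDim R ≤ 0) {f : R →+* S} {n : ℕ}
    (hf : f.IsStandardSmoothOfRelativeDimension n) : ringKrullDim S ≤ n := by
  -- Étale coordinates: `S` is étale, hence quasi-finite, over the polynomial ring in `n` variables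
  -- over `R`, whose dimension is `dim R + n`.
  obtain ⟨g, -, hg⟩ := hf.exists_etale_mvPolynomial
  algebraize [g]
  refine (ringKrullDim_le_of_quasiFinite (MvPolynomial (Fin n) R) S).trans ?_
  rw [MvPolynomial.ringKrullDim_of_isNoetherianRing, Nat.card_eq_fintype_card, Fintype.card_fin]
  exact (add_le_add_left hR _).trans (zero_add _).le

/-- A scheme that is smooth of relative dimension `d` over a field has dimension at most `d`. -/
lemma topologicalKrullDim_le_of_smoothOfRelativeDimension {k : Type u} [Field k] {X : Scheme.{u}}
    (f : X ⟶ Spec (CommRingCat.of k)) (d : ℕ) [SmoothOfRelativeDimension d f] :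
    topologicalKrullDim X ≤ d := by
  refine topologicalKrullDim_le_of_forall_exists_isOpenEmbedding _ fun x => ?_
  obtain ⟨U, hU, V, hV, hx, e, hs⟩ :=
    SmoothOfRelativeDimension.exists_isStandardSmoothOfRelativeDimension (n := d) (f := f) x
  refine ⟨V, inferInstance, Subtype.val, V.isOpenEmbedding', ⟨⟨x, hx⟩, rfl⟩, ?_⟩
  have hdim {Y : Scheme.{u}} {W : Y.Opens} (hW : IsAffineOpen W) :
      topologicalKrullDim W = ringKrullDim Γ(Y, W) := by
    rw [← PrimeSpectrum.topologicalKrullDim_eq_ringKrullDim Γ(Y, W)]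
    exact IsHomeomorph.topologicalKrullDim_eq _ hW.isoSpec.hom.homeomorph.isHomeomorph
  have hR : ringKrullDim Γ(Spec (CommRingCat.of k), U) ≤ 0 := by
    rw [← hdim hU]
    refine (topologicalKrullDim_subspace_le _ _).trans ?_
    exact (PrimeSpectrum.topologicalKrullDim_eq_ringKrullDim (R := k)).trans_le
      (ringKrullDim_eq_zero_of_field k).le
  have : IsNoetherianRing Γ(Spec (CommRingCat.of k), U) :=
    IsLocallyNoetherian.component_noetherian ⟨U, hU⟩
  rw [hdim hV]
  exact ringKrullDim_le_of_isStandardSmoothOfRelativeDimension hR hs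

/-! ### The locus of given relative dimension -/

/-- The relative dimension of a standard smooth homomorphism to a nontrivial ring is unique. -/
lemma isStandardSmooth_relativeDimension_unique {R S : Type*} [CommRing R] [CommRing S]
    [Nontrivial S] {f : R →+* S} {d e : ℕ} (hd : f.IsStandardSmoothOfRelativeDimension d)
    (he : f.IsStandardSmoothOfRelativeDimension e) : d = e := by
  algebraize [f]
  -- The relative dimension is the rank of the module of differentials.
  have h := Algebra.IsStandardSmoothOfRelativeDimension.rank_kaehlerDifferential (R := R) (S := S) d
  rw [Algebra.IsStandardSmoothOfRelativeDimension.rank_kaehlerDifferential (R := R) (S := S) e] at h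
  exact (Nat.cast_injective h).symm

/-- The two hypotheses come with different covers of `Spec S`. Near a closed point `p` one member
`a` of the first and one member `b` of the second are invertible, and over the localization at `a *
b` both relative dimensions are available. -/
lemma locally_relativeDimension_unique {R S : Type u} [CommRing R] [CommRing S]
    [Nontrivial S] {f : R →+* S} {d e : ℕ}
    (hd : RingHom.Locally (RingHom.IsStandardSmoothOfRelativeDimension d) f)
    (he : RingHom.Locally (RingHom.IsStandardSmoothOfRelativeDimension e) f) : d = e := by
  obtain ⟨p, hp⟩ := Ideal.exists_maximal S
  obtain ⟨s, hs, hsd⟩ := hd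
  obtain ⟨t, ht, hte⟩ := he
  have key {s : Set S} (hs : Ideal.span s = ⊤) : ∃ a ∈ s, a ∉ p := by
    by_contra! h
    exact hp.ne_top (top_le_iff.1 (hs ▸ Ideal.span_le.2 h))
  obtain ⟨a, ha, hap⟩ := key hs
  obtain ⟨b, hb, hbp⟩ := key ht
  let A := Localization.Away a
  let B := Localization.Away b
  -- `A'` and `B'` invert `a` and `b` in the two possible orders. Both are localizations of `S` at
  -- `a * b`, whence the isomorphism `ε` below.
  let A' := Localization.Away (algebraMap S A b)
  let B' := Localization.Away (algebraMap S B a)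
  have hA : IsLocalization.Away (a * b) A' := IsLocalization.Away.mul' A A' a b
  have hB : IsLocalization.Away (a * b) B' := IsLocalization.Away.mul B B' b a
  have hnt : Nontrivial A' := by
    rw [← not_subsingleton_iff_nontrivial,
      IsLocalization.subsingleton_iff (S := A') (M := Submonoid.powers (a * b))]
    rintro ⟨n, hn⟩
    exact hp.isPrime.mul_notMem hap hbp (hp.isPrime.mem_of_pow_mem n ((show (a * b) ^ n = 0 from hn) ▸ p.zero_mem))
  let ε : B' ≃ₐ[S] A' := IsLocalization.algEquiv (Submonoid.powers (a * b)) B' A'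
  have h1 : ((algebraMap A A').comp ((algebraMap S A).comp f)).IsStandardSmoothOfRelativeDimension
      d :=
    (RingHom.isStandardSmoothOfRelativeDimension_stableUnderCompositionWithLocalizationAway d).right
      _ (algebraMap S A b) _ (hsd a ha)
  have h2 : ((algebraMap B B').comp ((algebraMap S B).comp f)).IsStandardSmoothOfRelativeDimension
      e :=
    (RingHom.isStandardSmoothOfRelativeDimension_stableUnderCompositionWithLocalizationAway e).right
      _ (algebraMap S B a) _ (hte b hb)
  have h3 := RingHom.isStandardSmoothOfRelativeDimension_respectsIso.1 _ ε.toRingEquiv h2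
  refine isStandardSmooth_relativeDimension_unique h1 ?_
  convert h3 using 1
  ext x
  change algebraMap A A' (algebraMap S A (f x)) = ε (algebraMap B B' (algebraMap S B (f x)))
  rw [← IsScalarTower.algebraMap_apply, ← IsScalarTower.algebraMap_apply, ε.commutes]

/-! ### Decomposition of a smooth scheme by relative dimension -/

section RelDimLocus

variable {X S : Scheme.{u}} (f : X ⟶ S)

instance smoothOfRelativeDimension_isZariskiLocalAtSource (d : ℕ) :
    IsZariskiLocalAtSource (@SmoothOfRelativeDimension.{u} d) :=
  HasRingHomProperty.instIsZariskiLocalAtSource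
    (Q := RingHom.Locally (RingHom.IsStandardSmoothOfRelativeDimension d))

/-- The locus where a morphism is smooth of relative dimension `d`. -/
def relDimLocus (d : ℕ) : X.Opens :=
  ⨆ V : {V : X.Opens // SmoothOfRelativeDimension d (V.ι ≫ f)}, V.1

lemma le_relDimLocus {d : ℕ} {V : X.Opens} (h : SmoothOfRelativeDimension d (V.ι ≫ f)) :
    V ≤ relDimLocus f d :=
  le_iSup (fun V : {V : X.Opens // SmoothOfRelativeDimension d (V.ι ≫ f)} => V.1) ⟨V, h⟩

lemma mem_relDimLocus {d : ℕ} {x : X} : x ∈ relDimLocus f d ↔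
    ∃ V : X.Opens, SmoothOfRelativeDimension d (V.ι ≫ f) ∧ x ∈ V := by
  rw [relDimLocus, TopologicalSpace.Opens.mem_iSup]
  exact ⟨fun ⟨V, h⟩ => ⟨V.1, V.2, h⟩, fun ⟨V, h, hx⟩ => ⟨⟨V, h⟩, hx⟩⟩

/-- Smoothness of relative dimension `d` is local on the source. -/
lemma smoothOfRelativeDimension_of_forall_exists {d : ℕ}
    (h : ∀ x : X, ∃ (Y : Scheme.{u}) (g : Y ⟶ X), IsOpenImmersion g ∧ x ∈ Set.range g ∧
      SmoothOfRelativeDimension d (g ≫ f)) : SmoothOfRelativeDimension d f := by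
  choose Y g hg hx hs using h
  let 𝒰 : X.OpenCover := Scheme.Cover.mkOfCovers X Y g (fun x => ⟨x, hx x⟩) hg
  exact IsZariskiLocalAtSource.of_openCover (P := @SmoothOfRelativeDimension d) 𝒰 hs

lemma smoothOfRelativeDimension_comp_of_isOpenImmersion {Y : Scheme.{u}} (g : Y ⟶ X)
    [IsOpenImmersion g] (d : ℕ) (h : SmoothOfRelativeDimension d f) :
    SmoothOfRelativeDimension d (g ≫ f) :=
  IsZariskiLocalAtSource.comp (P := @SmoothOfRelativeDimension d) h g

/-- By locality on the source, a union of opens of relative dimension `d` is again of relative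
dimension `d`. Thus the locus is the largest such open. -/
lemma smoothOfRelativeDimension_relDimLocus (d : ℕ) :
    SmoothOfRelativeDimension d ((relDimLocus f d).ι ≫ f) := by
  refine smoothOfRelativeDimension_of_forall_exists _ fun x => ?_
  obtain ⟨V, hV, hx⟩ := (mem_relDimLocus f).1 (Subtype.prop (p := (· ∈ relDimLocus f d)) x)
  refine ⟨V, X.homOfLE (le_relDimLocus f hV), inferInstance, ⟨⟨x.1, hx⟩, ?_⟩, ?_⟩
  · apply (relDimLocus f d).ι.isOpenEmbedding.injective
    exact congrArg (fun g : V.toScheme ⟶ X => g ⟨x.1, hx⟩)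
      (X.homOfLE_ι (le_relDimLocus f hV))
  · rw [Scheme.homOfLE_ι_assoc]
    exact hV

lemma smoothOfRelativeDimension_iff_relDimLocus_eq_top (d : ℕ) :
    SmoothOfRelativeDimension d f ↔ relDimLocus f d = ⊤ := by
  constructor
  · intro h
    exact top_le_iff.1 (le_relDimLocus f
      (smoothOfRelativeDimension_comp_of_isOpenImmersion f _ d h))
  · intro h
    refine smoothOfRelativeDimension_of_forall_exists f fun x =>
      ⟨_, (relDimLocus f d).ι, inferInstance, ?_, smoothOfRelativeDimension_relDimLocus f d⟩
    rw [Scheme.Opens.range_ι, h]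
    trivial

/-- The relative dimension of a smooth morphism with non-empty source is unique. -/
lemma relativeDimension_unique [Nonempty X] {d e : ℕ} (hd : SmoothOfRelativeDimension d f)
    (he : SmoothOfRelativeDimension e f) : d = e := by
  obtain ⟨x⟩ := ‹Nonempty X›
  obtain ⟨_, ⟨U, hU, rfl⟩, hxU, -⟩ :=
    S.isBasis_affineOpens.exists_subset_of_mem_open (Set.mem_univ (f x)) isOpen_univ
  obtain ⟨_, ⟨V, hV, rfl⟩, hxV, hVU⟩ :=
    X.isBasis_affineOpens.exists_subset_of_mem_open hxU (U.2.preimage f.continuous)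
  have : Nonempty V := ⟨⟨x, hxV⟩⟩
  exact locally_relativeDimension_unique
    (HasRingHomProperty.appLE (P := @SmoothOfRelativeDimension d) f hd ⟨U, hU⟩ ⟨V, hV⟩ hVU)
    (HasRingHomProperty.appLE (P := @SmoothOfRelativeDimension e) f he ⟨U, hU⟩ ⟨V, hV⟩ hVU)

lemma disjoint_relDimLocus {d e : ℕ} (h : d ≠ e) :
    Disjoint (relDimLocus f d) (relDimLocus f e) := by
  rw [disjoint_iff]
  by_contra hne
  let W := relDimLocus f d ⊓ relDimLocus f e
  have : Nonempty W := by
    obtain ⟨x, hx⟩ := Set.nonempty_iff_ne_empty.2 fun h0 => hne (TopologicalSpace.Opens.ext h0)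
    exact ⟨⟨x, hx⟩⟩
  refine h (relativeDimension_unique (W.ι ≫ f) ?_ ?_)
  · rw [← X.homOfLE_ι (inf_le_left : W ≤ relDimLocus f d), Category.assoc]
    exact smoothOfRelativeDimension_comp_of_isOpenImmersion _ _ _
      (smoothOfRelativeDimension_relDimLocus f d)
  · rw [← X.homOfLE_ι (inf_le_right : W ≤ relDimLocus f e), Category.assoc]
    exact smoothOfRelativeDimension_comp_of_isOpenImmersion _ _ _
      (smoothOfRelativeDimension_relDimLocus f e)

/-- `Smooth` only provides standard smooth charts without a prescribed dimension. The dimension at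
`x` is read off from a submersive presentation on a chart around `x`. -/
lemma exists_mem_relDimLocus [Smooth f] (x : X) : ∃ d, x ∈ relDimLocus f d := by
  obtain ⟨U, hU, V, hV, hx, e, hs⟩ := Smooth.exists_isStandardSmooth f x
  algebraize [(f.appLE U V e).hom]
  obtain ⟨ι, σ, _, _, ⟨P⟩⟩ := ‹Algebra.IsStandardSmooth Γ(S, U) Γ(X, V)›
  have hP : RingHom.IsStandardSmoothOfRelativeDimension P.dimension (f.appLE U V e).hom :=
    ⟨ι, σ, _, inferInstance, P, rfl⟩
  refine ⟨P.dimension, le_relDimLocus f ?_ hx⟩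
  have : IsAffine _ := hU
  have : IsAffine _ := hV
  have h : SmoothOfRelativeDimension P.dimension (f.resLE U V e) := by
    rw [HasRingHomProperty.iff_of_isAffine (P := @SmoothOfRelativeDimension P.dimension)]
    refine ((RingHom.locally_respectsIso
      RingHom.isStandardSmoothOfRelativeDimension_respectsIso).arrow_mk_iso_iff
      (arrowResLEAppIso f U V e)).2 ?_
    exact RingHom.locally_of RingHom.isStandardSmoothOfRelativeDimension_respectsIso _ hP
  rw [← Scheme.Hom.resLE_comp_ι f e]
  -- The open immersion `U.ι` has relative dimension `0`, and relative dimensions add under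
  -- composition.
  exact inferInstanceAs (SmoothOfRelativeDimension (P.dimension + 0) (f.resLE U V e ≫ U.ι))

/-- Restriction gives one inclusion for every `d`. Equality follows because the loci of `f` cover
`X` while those of `g ≫ f` are pairwise disjoint. Applied to automorphisms, this makes the
decomposition equivariant. -/
lemma preimage_relDimLocus [Smooth f] {Y : Scheme.{u}} (g : Y ⟶ X) [IsOpenImmersion g] (d : ℕ) :
    g ⁻¹ᵁ relDimLocus f d = relDimLocus (g ≫ f) d := by
  have key (e : ℕ) : g ⁻¹ᵁ relDimLocus f e ≤ relDimLocus (g ≫ f) e := by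
    refine le_relDimLocus _ ?_
    rw [← morphismRestrict_ι_assoc]
    exact smoothOfRelativeDimension_comp_of_isOpenImmersion _ _ _
      (smoothOfRelativeDimension_relDimLocus f e)
  refine le_antisymm (key d) fun y hy => ?_
  obtain ⟨e, he⟩ := exists_mem_relDimLocus f (g y)
  obtain rfl : d = e := by
    by_contra hne
    exact (disjoint_relDimLocus (g ≫ f) hne).le_bot ⟨hy, key e he⟩
  exact he

lemma isClosed_relDimLocus [Smooth f] (d : ℕ) : IsClosed (relDimLocus f d : Set X) := by
  have : (relDimLocus f d : Set X)ᶜ = ⋃ e : {e // e ≠ d}, relDimLocus f e.1 := by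
    ext x
    simp only [Set.mem_compl_iff, Set.mem_iUnion]
    constructor
    · intro hx
      obtain ⟨e, he⟩ := exists_mem_relDimLocus f x
      exact ⟨⟨e, fun h => hx (h ▸ he)⟩, he⟩
    · rintro ⟨⟨e, hne⟩, he⟩ hx
      exact (disjoint_relDimLocus f hne).le_bot ⟨he, hx⟩
  rw [← isOpen_compl_iff, this]
  exact isOpen_iUnion fun e => (relDimLocus f e.1).isOpen

/-- The loci form a disjoint open cover, so a finite subcover must contain every non-empty one. -/
lemma finite_relDimLocus_ne_bot [Smooth f] [CompactSpace X] :
    {d | relDimLocus f d ≠ ⊥}.Finite := by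
  obtain ⟨t, ht⟩ := isCompact_univ.elim_finite_subcover (fun d => (relDimLocus f d : Set X))
    (fun d => (relDimLocus f d).isOpen) fun x _ =>
      Set.mem_iUnion.2 (exists_mem_relDimLocus f x)
  refine t.finite_toSet.subset fun d hd => ?_
  obtain ⟨x, hx⟩ := Set.nonempty_iff_ne_empty.2 fun h0 => hd (TopologicalSpace.Opens.ext h0)
  obtain ⟨e, he, hxe⟩ := Set.mem_iUnion₂.1 (ht (Set.mem_univ x))
  obtain rfl : d = e := by
    by_contra hne
    exact (disjoint_relDimLocus f hne).le_bot ⟨hx, hxe⟩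
  exact he

end RelDimLocus

variable {k : Type u} [Field k]

/-! ### Equivariant subschemes -/

namespace EqSch

/-- A scheme of finite type over a field is Noetherian. Compactness makes the decomposition by
dimension finite, and the Noetherian property makes dimension drop on nowhere dense closed subsets.
-/
instance (X : EqSch k) : IsNoetherian X.sch.left where
  __ := LocallyOfFiniteType.isLocallyNoetherian X.sch.hom
  __ := QuasiCompact.compactSpace_of_compactSpace X.sch.hom

/-- The automorphism of the underlying scheme by which `1 ∈ Ẑ` acts. -/
def gen (X : EqSch k) : X.sch.left ⟶ X.sch.left := (X.action.act ZHat.one).hom.left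

instance (X : EqSch k) : IsIso X.gen := 
  ((Over.forget _).mapIso (X.action.act ZHat.one)).isIso_hom

lemma gen_hom (X : EqSch k) : X.gen ≫ X.sch.hom = X.sch.hom := Over.w (X.action.act ZHat.one).hom

lemma gen_schHom {X Y : EqSch k} (f : X ⟶ Y) : X.gen ≫ schHom f = schHom f ≫ Y.gen :=
  congrArg (fun g => CommaMorphism.left g) (f.equivariant ZHat.one)

lemma hom_pow_comp {X : EqSch k} {Y : Over (Spec (CommRingCat.of k))} (ι : Y ⟶ X.sch) (g : Y ⟶ Y)
    (h : g ≫ ι = ι ≫ (X.action.act ZHat.one).hom) (N : ℕ) :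
    End.asHom (End.of g ^ N) ≫ ι = ι ≫ (X.action.act ZHat.one ^ N).hom := by
  induction N with
  | zero => exact (Category.id_comp ι).trans (Category.comp_id ι).symm
  | succ N ih =>
    rw [pow_succ', pow_succ', ZHatAction.hom_mul, ← Category.assoc, ← ih, Category.assoc, ← h,
      ← Category.assoc]
    rfl

/-- Finite order passes from the generator on `X` to the endomorphism `g` of a stable subobject,
since `ι` can be cancelled in `g ^ N ≫ ι = ι`. -/
lemma exists_pow_eq_one_of_mono {X : EqSch k} {Y : Over (Spec (CommRingCat.of k))} (ι : Y ⟶ X.sch)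
    [Mono ι] (g : Y ⟶ Y) (h : g ≫ ι = ι ≫ (X.action.act ZHat.one).hom) :
    ∃ N, 0 < N ∧ End.of g ^ N = 1 := by
  obtain ⟨N, hN, h1⟩ := isOfFinOrder_iff_pow_eq_one.1 X.action.isOfFinOrder_act_one
  refine ⟨N, hN, ?_⟩
  have := hom_pow_comp ι g h N
  rw [h1] at this
  exact (cancel_mono ι).1 (this.trans ((Category.comp_id ι).trans (Category.id_comp ι).symm))

/-- The restriction `g` need only be an endomorphism of `Y`: some positive power of it is the
identity, which makes it invertible. -/
lemma exists_aut_of_mono {X : EqSch k} {Y : Scheme.{u}} (ι : Y ⟶ X.sch.left) [Mono ι] (g : Y ⟶ Y)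
    (h : g ≫ ι = ι ≫ X.gen) : ∃ a : Aut (Over.mk (ι ≫ X.sch.hom)), IsOfFinOrder a ∧
    a.hom ≫ (Over.homMk ι rfl : Over.mk (ι ≫ X.sch.hom) ⟶ X.sch) =
      Over.homMk ι rfl ≫ (X.action.act ZHat.one).hom := by
  let ι' : Over.mk (ι ≫ X.sch.hom) ⟶ X.sch := Over.homMk ι rfl
  let g' : Over.mk (ι ≫ X.sch.hom) ⟶ Over.mk (ι ≫ X.sch.hom) := Over.homMk g (by
    change g ≫ ι ≫ X.sch.hom = ι ≫ X.sch.hom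
    rw [← Category.assoc, h, Category.assoc, gen_hom])
  have hg : g' ≫ ι' = ι' ≫ (X.action.act ZHat.one).hom := Over.OverMorphism.ext h
  have : Mono ι' := (Over.forget _).mono_of_mono_map (f := ι') (inferInstanceAs (Mono ι))
  obtain ⟨N, hN, h1⟩ := exists_pow_eq_one_of_mono ι' g' hg
  let u : (End (Over.mk (ι ≫ X.sch.hom)))ˣ := (IsUnit.of_pow_eq_one h1 hN.ne').unit
  refine ⟨Aut.unitsEndEquivAut _ u, isOfFinOrder_iff_pow_eq_one.2 ⟨N, hN, ?_⟩, hg⟩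
  rw [← map_pow, EmbeddingLike.map_eq_one_iff, Units.ext_iff, Units.val_pow_eq_pow_val]
  exact h1

section OfMono

variable {X : EqSch k} {Y : Scheme.{u}} (ι : Y ⟶ X.sch.left) [Mono ι] [IsSeparated ι]
  [LocallyOfFiniteType ι] [QuasiCompact ι] (g : Y ⟶ Y) (h : g ≫ ι = ι ≫ X.gen)

/-- A subscheme that is stable under the action of `1 ∈ Ẑ` inherits an action of `Ẑ`. -/
def ofMono : EqSch k where
  sch := Over.mk (ι ≫ X.sch.hom)
  isSeparated := inferInstanceAs (IsSeparated (ι ≫ X.sch.hom))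
  locallyOfFiniteType := inferInstanceAs (LocallyOfFiniteType (ι ≫ X.sch.hom))
  quasiCompact := inferInstanceAs (QuasiCompact (ι ≫ X.sch.hom))
  action := ZHatAction.ofFinOrder _ (exists_aut_of_mono ι g h).choose_spec.1

/-- The inclusion of a stable subscheme. -/
def ofMonoIncl : ofMono ι g h ⟶ X :=
  ⟨Over.homMk ι rfl, ZHatAction.comm_of_one _ _ _ (by
    have e : (ofMono ι g h).action.act ZHat.one = (exists_aut_of_mono ι g h).choose :=
      ZHatAction.ofFinOrder_act_one _ (exists_aut_of_mono ι g h).choose_spec.1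
    rw [e]
    exact (exists_aut_of_mono ι g h).choose_spec.2)⟩

end OfMono

end EqSch

/-! ### Open and closed subschemes over the base -/

variable {B : EqSch k}

/-- The morphism of schemes underlying a morphism over `B`. -/
abbrev overHom {X Y : Over B} (f : X ⟶ Y) : X.left.sch.left ⟶ Y.left.sch.left :=
  EqSch.schHom f.left

/-- An open subset that is stable under the action is an equivariant open subscheme. -/
lemma exists_openSubscheme (X : Over B) (V : X.left.sch.left.Opens)
    (hV : X.left.gen ⁻¹ᵁ V = V) :
    ∃ (U : Over B) (j : U ⟶ X), IsOpenImmersion (overHom j) ∧ Set.range (overHom j) = V := by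
  have hr : Set.range (V.ι ≫ X.left.gen) ⊆ Set.range V.ι := by
    rintro _ ⟨x, rfl⟩
    rw [Scheme.Opens.range_ι, Scheme.Hom.comp_apply]
    exact (congrArg (V.ι x ∈ ·) hV).mpr (Subtype.prop (p := (· ∈ V)) x)
  let j := EqSch.ofMonoIncl (X := X.left) V.ι
    (IsOpenImmersion.lift V.ι (V.ι ≫ X.left.gen) hr) (IsOpenImmersion.lift_fac _ _ _)
  exact ⟨Over.mk (j ≫ X.hom), Over.homMk j rfl, inferInstanceAs (IsOpenImmersion V.ι),
    Scheme.Opens.range_ι V⟩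

/-- A closed subset that is stable under the action is an equivariant closed subscheme. -/
lemma exists_closedSubscheme (X : Over B) (Z : Set X.left.sch.left) (hZ : IsClosed Z)
    (hg : X.left.gen '' Z = Z) :
    ∃ (Y : Over B) (i : Y ⟶ X), IsClosedImmersion (overHom i) ∧ Set.range (overHom i) = Z := by
  -- The reduced structure on `Z` is canonical: an automorphism that preserves `Z` preserves its
  -- vanishing ideal, and hence restricts to the subscheme.
  let I : X.left.sch.left.IdealSheafData := .vanishingIdeal ⟨Z, hZ⟩
  have hI : I.map X.left.gen = I := by
    rw [Scheme.IdealSheafData.map_vanishingIdeal]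
    congr 1
    ext1
    change closure (X.left.gen '' Z) = Z
    rw [hg, hZ.closure_eq]
  have hk : I.subschemeι.ker ≤ (I.subschemeι ≫ X.left.gen).ker := by
    rw [← Scheme.IdealSheafData.map_ker, Scheme.IdealSheafData.ker_subschemeι, hI]
  let j := EqSch.ofMonoIncl (X := X.left) I.subschemeι
    (IsClosedImmersion.lift I.subschemeι (I.subschemeι ≫ X.left.gen) hk)
    (IsClosedImmersion.lift_fac _ _ _)
  refine ⟨Over.mk (j ≫ X.hom), Over.homMk j rfl, inferInstanceAs (IsClosedImmersion I.subschemeι),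
    ?_⟩
  change Set.range I.subschemeι = Z
  rw [Scheme.IdealSheafData.range_subschemeι, Scheme.IdealSheafData.coe_support_vanishingIdeal]
  rfl

/-- A morphism whose image lies in an equivariant open subscheme factors through it. -/
lemma exists_lift {X U T : Over B} (j : U ⟶ X) (hj : IsOpenImmersion (overHom j)) (f : T ⟶ X)
    (h : Set.range (overHom f) ⊆ Set.range (overHom j)) : ∃ l : T ⟶ U, l ≫ j = f := by
  let l : T.left.sch.left ⟶ U.left.sch.left := IsOpenImmersion.lift (overHom j) (overHom f) h
  have hl : l ≫ overHom j = overHom f := IsOpenImmersion.lift_fac _ _ _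
  let l' : T.left.sch ⟶ U.left.sch := Over.homMk l (by
    have h1 : overHom j ≫ X.left.sch.hom = U.left.sch.hom := Over.w j.left.hom
    have h2 : overHom f ≫ X.left.sch.hom = T.left.sch.hom := Over.w f.left.hom
    rw [← h1, ← h2, ← hl, Category.assoc])
  let l'' : T.left ⟶ U.left := ⟨l', ZHatAction.comm_of_one _ _ _ (by
    ext1
    -- Equivariance of the lift may be tested after composing with the monomorphism `overHom j`,
    -- where it becomes equivariance of `f` and `j`.
    change T.left.gen ≫ l = l ≫ U.left.gen
    rw [← cancel_mono (overHom j), Category.assoc, hl, Category.assoc, EqSch.gen_schHom,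
      EqSch.gen_schHom, ← Category.assoc, hl])⟩
  have hl'' : l'' ≫ j.left = f.left := EqSch.Hom.ext (Over.OverMorphism.ext hl)
  refine ⟨Over.homMk l'' ?_, Over.OverMorphism.ext hl''⟩
  rw [← Over.w j, ← Over.w f, ← hl'', Category.assoc]

lemma overHom_comp {X Y Z : Over B} (f : X ⟶ Y) (g : Y ⟶ Z) :
    overHom (f ≫ g) = overHom f ≫ overHom g := rfl

lemma range_overHom_comp {X Y Z : Over B} (f : X ⟶ Y) (g : Y ⟶ Z) :
    Set.range (overHom (f ≫ g)) = overHom g '' Set.range (overHom f) := by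
  exact Set.range_comp (overHom g) (overHom f)

/-- The image of an equivariant morphism is stable under the action. -/
lemma gen_image_range {X Y : Over B} (f : Y ⟶ X) :
    X.left.gen '' Set.range (overHom f) = Set.range (overHom f) := by
  have h : X.left.gen ∘ overHom f = overHom f ∘ Y.left.gen :=
    congrArg (fun g : Y.left.sch.left ⟶ X.left.sch.left => (g : Y.left.sch.left → X.left.sch.left))
      (EqSch.gen_schHom f.left).symm
  have h' : Set.range Y.left.gen = Set.univ := Y.left.gen.homeomorph.surjective.range_eq
  rw [← Set.range_comp, h, Set.range_comp, h', Set.image_univ]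

/-- The complement of an equivariant open subscheme is an equivariant closed subscheme. -/
lemma exists_isPartition {X U : Over B} (j : U ⟶ X) (hj : IsOpenImmersion (overHom j)) :
    ∃ (Y : Over B) (i : Y ⟶ X), IsClosedImmersion (overHom i) ∧ IsPartition i.left j.left := by
  obtain ⟨Y, i, hi, hr⟩ := exists_closedSubscheme X (Set.range (overHom j))ᶜ
    (overHom j).isOpenEmbedding.isOpen_range.isClosed_compl (by
      rw [Set.image_compl_eq (f := X.left.gen) X.left.gen.homeomorph.bijective, gen_image_range])
  refine ⟨Y, i, hi, ?_⟩
  rw [IsPartition, hr]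
  exact isCompl_compl.symm

/-- A surjective open immersion over `B` is an isomorphism. -/
lemma nonempty_iso_of_isOpenImmersion {X U : Over B} (j : U ⟶ X)
    (hj : IsOpenImmersion (overHom j)) (h : Set.range (overHom j) = Set.univ) :
    Nonempty (U ≅ X) := by
  obtain ⟨l, hl⟩ := exists_lift j hj (𝟙 X) (h ▸ Set.subset_univ _)
  refine ⟨⟨j, l, ?_, hl⟩⟩
  refine Over.OverMorphism.ext (EqSch.Hom.ext (Over.OverMorphism.ext ?_))
  change overHom (j ≫ l) = overHom (𝟙 U)
  rw [← cancel_mono (overHom j), ← overHom_comp, ← overHom_comp, Category.assoc, hl,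
    Category.comp_id, Category.id_comp]

lemma isOpenImmersion_of_comp {X U V : Over B} (l : V ⟶ U) (j : U ⟶ X)
    (hj : IsOpenImmersion (overHom j)) (h : IsOpenImmersion (overHom (l ≫ j))) :
    IsOpenImmersion (overHom l) :=
  have : IsOpenImmersion (overHom l ≫ overHom j) := h
  IsOpenImmersion.of_comp (overHom l) (overHom j)

/-! ### Components of pure dimension -/

lemma overHom_structure {X Y : Over B} (f : Y ⟶ X) :
    overHom f ≫ X.left.sch.hom = Y.left.sch.hom := Over.w f.left.hom

lemma smooth_of_overHom {X Y : Over B} (f : Y ⟶ X) (hf : IsOpenImmersion (overHom f))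
    (hX : Smooth X.left.sch.hom) : Smooth Y.left.sch.hom := by
  rw [← overHom_structure f]
  infer_instance

namespace SmoothOver

/-- The structure morphism to the spectrum of the ground field. -/
abbrev str (X : SmoothOver B) : X.1.left.sch.left ⟶ Spec (CommRingCat.of k) := X.1.left.sch.hom

instance (X : SmoothOver B) : Smooth X.str := X.2

lemma preimage_relDimLocus {X Y : SmoothOver B} (f : Y.1 ⟶ X.1) (hf : IsOpenImmersion (overHom f))
    (d : ℕ) : overHom f ⁻¹ᵁ relDimLocus X.str d = relDimLocus Y.str d := by
  rw [BostConnes.preimage_relDimLocus, overHom_structure]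

lemma gen_preimage_relDimLocus (X : SmoothOver B) (d : ℕ) :
    X.1.left.gen ⁻¹ᵁ relDimLocus X.str d = relDimLocus X.str d := by
  rw [BostConnes.preimage_relDimLocus, EqSch.gen_hom]

lemma exists_open (X : SmoothOver B) (V : X.1.left.sch.left.Opens)
    (hV : X.1.left.gen ⁻¹ᵁ V = V) :
    ∃ (U : SmoothOver B) (j : U.1 ⟶ X.1), IsOpenImmersion (overHom j) ∧
      Set.range (overHom j) = V := by
  obtain ⟨U, j, hj, hr⟩ := exists_openSubscheme X.1 V hV
  exact ⟨⟨U, smooth_of_overHom j hj X.2⟩, j, hj, hr⟩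

/-- The part of pure dimension `d` of a smooth equivariant scheme. -/
def component (X : SmoothOver B) (d : ℕ) : SmoothOver B :=
  (X.exists_open (relDimLocus X.str d) (X.gen_preimage_relDimLocus d)).choose

/-- The inclusion of the part of pure dimension `d`. -/
def componentIncl (X : SmoothOver B) (d : ℕ) : (X.component d).1 ⟶ X.1 :=
  (X.exists_open (relDimLocus X.str d) (X.gen_preimage_relDimLocus d)).choose_spec.choose

instance (X : SmoothOver B) (d : ℕ) : IsOpenImmersion (overHom (X.componentIncl d)) :=
  (X.exists_open (relDimLocus X.str d) (X.gen_preimage_relDimLocus d)).choose_spec.choose_spec.1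

lemma range_componentIncl (X : SmoothOver B) (d : ℕ) :
    Set.range (overHom (X.componentIncl d)) = relDimLocus X.str d :=
  (X.exists_open (relDimLocus X.str d) (X.gen_preimage_relDimLocus d)).choose_spec.choose_spec.2

lemma smoothOfRelativeDimension_component (X : SmoothOver B) (d : ℕ) :
    SmoothOfRelativeDimension d (X.component d).str := by
  rw [smoothOfRelativeDimension_iff_relDimLocus_eq_top,
    ← preimage_relDimLocus (X.componentIncl d) inferInstance]
  refine top_le_iff.1 fun x _ => ?_
  exact (X.range_componentIncl d).le ⟨x, rfl⟩

lemma dim_component_le (X : SmoothOver B) (d : ℕ) : dim (X.component d).1 ≤ d :=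
  have := X.smoothOfRelativeDimension_component d
  topologicalKrullDim_le_of_smoothOfRelativeDimension (X.component d).str d

/-- An equivariant open immersion of smooth schemes restricts to the parts of pure dimension. -/
lemma exists_component_hom {X U : SmoothOver B} (j : U.1 ⟶ X.1)
    (hj : IsOpenImmersion (overHom j)) (d : ℕ) :
    ∃ l : (U.component d).1 ⟶ (X.component d).1, IsOpenImmersion (overHom l) ∧
      Set.range (overHom l) = overHom (X.componentIncl d) ⁻¹' Set.range (overHom j) := by
  -- As subsets of `X`, the degree `d` part of `U` is the intersection of `U` with that of `X`.
  have hL : overHom j ⁻¹' (relDimLocus X.str d) = (relDimLocus U.str d : Set _) :=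
    congrArg (fun V : U.1.left.sch.left.Opens => (V : Set U.1.left.sch.left))
      (preimage_relDimLocus j hj d)
  have hr : Set.range (overHom (U.componentIncl d ≫ j)) =
      (relDimLocus X.str d : Set _) ∩ Set.range (overHom j) := by
    rw [range_overHom_comp, range_componentIncl, ← hL, Set.image_preimage_eq_inter_range]
  obtain ⟨l, hl⟩ := exists_lift (X.componentIncl d) inferInstance (U.componentIncl d ≫ j)
    (by rw [hr, range_componentIncl]; exact Set.inter_subset_left)
  refine ⟨l, isOpenImmersion_of_comp l (X.componentIncl d) inferInstance ?_, ?_⟩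
  · rw [hl, overHom_comp]
    infer_instance
  · have hinj : Function.Injective (overHom (X.componentIncl d)) :=
      (overHom (X.componentIncl d)).isOpenEmbedding.injective
    rw [← hinj.preimage_image (Set.range (overHom l)), ← range_overHom_comp, hl, hr,
      Set.preimage_inter, ← range_componentIncl, Set.preimage_range, Set.univ_inter]

end SmoothOver

/-! ### Classes in the graded pieces -/

/-- An empty scheme is partitioned by two copies of itself, so its class equals its own double. -/
lemma K0.mk_eq_zero_of_isEmpty (X : Over B) (h : IsEmpty X.left.sch.left) : K0.mk X = 0 := by
  have h0 : IsIso (overHom (𝟙 X)) := inferInstanceAs (IsIso (𝟙 X.left.sch.left))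
  have := K0.mk_eq_add (𝟙 X) (𝟙 X) (inferInstanceAs (IsClosedImmersion (overHom (𝟙 X))))
    (inferInstanceAs (IsOpenImmersion (overHom (𝟙 X)))) (by
      have hr : Set.range (overHom (𝟙 X)) = ∅ := Set.range_eq_empty _
      have hu : (∅ : Set X.left.sch.left) = Set.univ := Set.univ_eq_empty_iff.2 h ▸ rfl
      rw [IsPartition, hr]
      exact ⟨disjoint_bot_left, codisjoint_iff.2 ((Set.union_empty _).trans hu)⟩)
  rwa [left_eq_add] at this

/-- The class of `X → B` with `dim X ≤ d` in `F_d / F_{d-1}`. -/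
def grClass (d : ℕ) (X : Over B) (h : dim X ≤ d) :
    K0.fil B d ⧸ (K0.filLT B d).addSubgroupOf (K0.fil B d) :=
  QuotientAddGroup.mk ⟨K0.mk X, AddSubgroup.subset_closure ⟨X, h, rfl⟩⟩

lemma GrK0.mk_eq_of (d : ℕ) (X : Over B) (h : dim X ≤ d) : GrK0.mk d X h =
    DirectSum.of (fun d => K0.fil B d ⧸ (K0.filLT B d).addSubgroupOf (K0.fil B d)) d
      (grClass d X h) := rfl

lemma grClass_eq_of_sub_mem {d : ℕ} {X Y : Over B} (hX : dim X ≤ d) (hY : dim Y ≤ d)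
    (h : K0.mk X - K0.mk Y ∈ K0.filLT B d) : grClass d X hX = grClass d Y hY := by
  refine (QuotientAddGroup.eq_iff_sub_mem).2 ?_
  exact h

lemma grClass_eq_of_iso {d : ℕ} {X Y : Over B} (hX : dim X ≤ d) (hY : dim Y ≤ d)
    (e : X ≅ Y) : grClass d X hX = grClass d Y hY :=
  grClass_eq_of_sub_mem hX hY (by rw [K0.mk_eq_of_iso e, sub_self]; exact zero_mem _)

lemma grClass_eq_add {d : ℕ} {X Y Z : Over B} (hX : dim X ≤ d) (hY : dim Y ≤ d)
    (hZ : dim Z ≤ d) (h : K0.mk X = K0.mk Y + K0.mk Z) :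
    grClass d X hX = grClass d Y hY + grClass d Z hZ :=
  congrArg QuotientAddGroup.mk (Subtype.ext h)

lemma grClass_eq_zero {d : ℕ} {X : Over B} (hX : dim X ≤ d) (h : IsEmpty X.left.sch.left) :
    grClass d X hX = 0 :=
  congrArg QuotientAddGroup.mk (Subtype.ext (K0.mk_eq_zero_of_isEmpty X h))

/-- A dense open subscheme of a scheme of dimension at most `d` has the same class in
`F_d / F_{d-1}`. -/
lemma grClass_eq_of_dense {d : ℕ} {X U : Over B} (hX : dim X ≤ d) (hU : dim U ≤ d) (j : U ⟶ X)
    (hj : IsOpenImmersion (overHom j)) (hd : DenseRange (overHom j)) :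
    grClass d X hX = grClass d U hU := by
  obtain ⟨Z, i, hi, hij⟩ := exists_isPartition j hj
  refine grClass_eq_of_sub_mem hX hU ?_
  -- The difference of the two classes is the class of the complement `Z`, which is nowhere dense
  -- and therefore lies in `F_{d-1}`.
  rw [K0.mk_eq_add i j hi hj hij, add_sub_cancel_right]
  refine AddSubgroup.subset_closure ⟨Z, ?_, rfl⟩
  refine topologicalKrullDim_lt_of_isClosedEmbedding (overHom i).isClosedEmbedding ?_ hX
  rw [(hij : IsCompl (Set.range (overHom i)) (Set.range (overHom j))).compl_eq]
  exact hd

/-- The class of the part of pure dimension `d` in `F_d / F_{d-1}`. -/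
def componentClass (X : SmoothOver B) (d : ℕ) :
    K0.fil B d ⧸ (K0.filLT B d).addSubgroupOf (K0.fil B d) :=
  grClass d (X.component d).1 (X.dim_component_le d)

lemma componentClass_eq_of_dense {X U : SmoothOver B} (j : U.1 ⟶ X.1)
    (hj : IsOpenImmersion (overHom j)) (hd : DenseRange (overHom j)) (d : ℕ) :
    componentClass X d = componentClass U d := by
  obtain ⟨l, hl, hr⟩ := SmoothOver.exists_component_hom j hj d
  refine grClass_eq_of_dense _ _ l hl ?_
  rw [DenseRange, hr]
  exact hd.preimage (overHom (X.componentIncl d)).isOpenEmbedding.isOpenMap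

lemma componentClass_eq_add {X Y Z : SmoothOver B} (i : Y.1 ⟶ X.1) (j : Z.1 ⟶ X.1)
    (hi : IsOpenImmersion (overHom i)) (hj : IsOpenImmersion (overHom j))
    (hij : IsPartition i.left j.left) (d : ℕ) :
    componentClass X d = componentClass Y d + componentClass Z d := by
  obtain ⟨l, hl, hrl⟩ := SmoothOver.exists_component_hom i hi d
  obtain ⟨m, hm, hrm⟩ := SmoothOver.exists_component_hom j hj d
  have hlm : IsPartition l.left m.left := by
    rw [IsPartition, hrl, hrm]
    exact IsCompl.preimage _ hij
  refine grClass_eq_add _ _ _ (K0.mk_eq_add l m ?_ hm hlm)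
  -- The scissor relation asks for a closed piece. The open piece `Y_d` is also closed, being the
  -- complement of the open piece `Z_d`.
  refine IsClosedImmersion.of_isPreimmersion _ ?_
  rw [← isOpen_compl_iff, IsCompl.compl_eq hlm]
  exact (overHom m).isOpenEmbedding.isOpen_range

lemma componentClass_eq_zero (X : SmoothOver B) (d : ℕ) (h : relDimLocus X.str d = ⊥) :
    componentClass X d = 0 := by
  refine grClass_eq_zero _ ⟨fun x => ?_⟩
  have := (X.range_componentIncl d).le ⟨x, rfl⟩
  rw [h] at this
  exact this

/-! ### The class map -/

/-- The sum of the classes of the parts of pure dimension of a smooth equivariant scheme. -/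
def smoothClass (X : SmoothOver B) : GrK0 B :=
  DirectSum.mk (fun d => K0.fil B d ⧸ (K0.filLT B d).addSubgroupOf (K0.fil B d))
    (finite_relDimLocus_ne_bot X.str).toFinset (fun d => componentClass X d)

/-- Outside the finite support the component is empty and its class is zero, so the formula holds in
every degree. Identities between classes can then be checked degree by degree. -/
lemma smoothClass_apply (X : SmoothOver B) (d : ℕ) : smoothClass X d = componentClass X d := by
  by_cases h : relDimLocus X.str d = ⊥
  · rw [componentClass_eq_zero X d h]
    exact DirectSum.mk_apply_of_notMem (by simpa using h)
  · exact DirectSum.mk_apply_of_mem (by simpa using h)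

/-- The morphism `Ψ : Burn^Ẑ(B, α_B) → gr K_0^Ẑ(B, α_B)`. -/
def classMap (B : EqSch k) : Burn B →+ GrK0 B :=
  QuotientAddGroup.lift _ (FreeAbelianGroup.lift smoothClass) (by
    rw [AddSubgroup.closure_le]
    rintro _ (⟨X, U, j, hj, hd, rfl⟩ | ⟨X, Y, Z, i, j, hi, hj, hij, rfl⟩)
    · have h : smoothClass X = smoothClass U := DFinsupp.ext fun d => by
        have := componentClass_eq_of_dense j hj hd d
        rwa [← smoothClass_apply, ← smoothClass_apply] at this
      simp [h]
    · have h : smoothClass X = smoothClass Y + smoothClass Z := DFinsupp.ext fun d => by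
        have := componentClass_eq_add i j hi hj hij d
        rwa [← smoothClass_apply, ← smoothClass_apply, ← smoothClass_apply] at this
      simp [h])

lemma classMap_mk (X : SmoothOver B) : classMap B (Burn.mk X) = smoothClass X :=
  FreeAbelianGroup.lift_apply_of _ _

lemma isClassMap_classMap (B : EqSch k) : IsClassMap (classMap B) := by
  intro d X hX
  have hdim : dim X.1 ≤ d := topologicalKrullDim_le_of_smoothOfRelativeDimension X.str d
  refine ⟨hdim, ?_⟩
  have htop := (smoothOfRelativeDimension_iff_relDimLocus_eq_top X.str d).1 hX
  rw [classMap_mk]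
  refine DFinsupp.ext fun e => ?_
  refine (smoothClass_apply X e).trans ?_
  -- In degree `d` the component is all of `X`. In every other degree its locus is disjoint from the
  -- whole space, hence empty.
  by_cases h : e = d
  · subst h
    rw [GrK0.mk_eq_of, DirectSum.of_eq_same]
    obtain ⟨ε⟩ := nonempty_iso_of_isOpenImmersion (X.componentIncl e) inferInstance (by
      rw [X.range_componentIncl, htop]; rfl)
    exact grClass_eq_of_iso _ hdim ε
  · rw [GrK0.mk_eq_of, DirectSum.of_eq_of_ne _ _ _ h]
    refine componentClass_eq_zero X e ?_
    have := disjoint_relDimLocus X.str h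
    rwa [htop, disjoint_top] at this

/-! ### Uniqueness of the class map -/

lemma Burn.mk_eq_add {X Y Z : SmoothOver B} (i : Y.1 ⟶ X.1) (j : Z.1 ⟶ X.1)
    (hi : IsOpenImmersion (overHom i)) (hj : IsOpenImmersion (overHom j))
    (hij : IsPartition i.left j.left) : Burn.mk X = Burn.mk Y + Burn.mk Z := by
  have h0 : (QuotientAddGroup.mk (FreeAbelianGroup.of X - FreeAbelianGroup.of Y -
      FreeAbelianGroup.of Z) : Burn B) = 0 :=
    (QuotientAddGroup.eq_zero_iff _).2 (AddSubgroup.subset_closure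
      (Or.inr ⟨X, Y, Z, i, j, hi, hj, hij, rfl⟩))
  have h : Burn.mk X - Burn.mk Y - Burn.mk Z = 0 := h0
  rwa [sub_sub, sub_eq_zero] at h

/-- Homomorphisms from the Burnside group are determined by their values on the classes of schemes
of pure dimension. -/
lemma Burn.hom_ext_of_pure {A : Type*} [AddCommGroup A] {φ ψ : Burn B →+ A}
    (h : ∀ (d : ℕ) (X : SmoothOver B), SmoothOfRelativeDimension d X.str →
      φ (Burn.mk X) = ψ (Burn.mk X)) : φ = ψ := by
  -- Induction on a finite set `S` that contains all dimensions occurring in `X`. Each step splits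
  -- off the part of one dimension.
  have key (S : Finset ℕ) : ∀ X : SmoothOver B,
      (∀ x : X.1.left.sch.left, ∃ d ∈ S, x ∈ relDimLocus X.str d) →
        φ (Burn.mk X) = ψ (Burn.mk X) := by
    induction S using Finset.induction_on with
    | empty =>
      intro X hX
      -- No dimension occurs, so `X` is empty and vacuously of pure dimension `0`.
      exact h 0 X ⟨fun x => by simpa using hX x⟩
    | insert a S ha ih =>
      intro X hX
      -- The remainder is open because the locus of dimension `a` is closed. It is stable under the
      -- action because that locus is.
      let V : X.1.left.sch.left.Opens :=
        ⟨(relDimLocus X.str a : Set _)ᶜ, (isClosed_relDimLocus X.str a).isOpen_compl⟩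
      obtain ⟨Z, j, hj, hr⟩ := X.exists_open V (TopologicalSpace.Opens.ext (congrArg compl
        (congrArg (fun W : X.1.left.sch.left.Opens => (W : Set X.1.left.sch.left))
          (X.gen_preimage_relDimLocus a))))
      have hp : IsPartition (X.componentIncl a).left j.left := by
        rw [IsPartition, hr, X.range_componentIncl]
        exact isCompl_compl
      rw [Burn.mk_eq_add (X.componentIncl a) j inferInstance hj hp, map_add, map_add,
        h a _ (X.smoothOfRelativeDimension_component a), ih Z fun z => ?_]
      obtain ⟨d, hd, hz⟩ := hX (overHom j z)
      have hza : overHom j z ∈ (V : Set _) := hr.le ⟨z, rfl⟩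
      refine ⟨d, (Finset.mem_insert.1 hd).resolve_left fun h => hza (h ▸ hz), ?_⟩
      rw [← SmoothOver.preimage_relDimLocus j hj]
      exact hz
  refine QuotientAddGroup.addMonoidHom_ext _ (FreeAbelianGroup.lift_ext _ _ fun X => ?_)
  refine key (finite_relDimLocus_ne_bot X.str).toFinset X fun x => ?_
  obtain ⟨d, hd⟩ := exists_mem_relDimLocus X.str x
  refine ⟨d, ?_, hd⟩
  rw [Set.Finite.mem_toFinset]
  exact fun h => (h ▸ hd : x ∈ (⊥ : X.1.left.sch.left.Opens))

lemma eq_classMap {Ψ : Burn B →+ GrK0 B} (h : IsClassMap Ψ) : Ψ = classMap B := by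
  refine Burn.hom_ext_of_pure fun d X hX => ?_
  obtain ⟨_, h1⟩ := h d X hX
  obtain ⟨_, h2⟩ := isClassMap_classMap B d X hX
  exact h1.trans h2.symm

/-! ### Compatibility with functors -/

lemma K0.map_mk {F : EqSch k ⥤ EqSch k} (hF : IsGeometric F) (X : Over B) :
    K0.map hF B (K0.mk X) = K0.mk ((Over.post F).obj X) :=
  K0.lift_mk _ _ _

/-- An inequality of dimensions is enough, as both `F_d` and `F_{d-1}` are generated by classes
subject only to an upper bound on the dimension. -/
lemma preservesFil_map {F : EqSch k ⥤ EqSch k} (hF : IsGeometric F)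
    (hdim : ∀ X : EqSch k,
      topologicalKrullDim (F.obj X).sch.left ≤ topologicalKrullDim X.sch.left) (B : EqSch k) :
    PreservesFil (K0.map hF B) := by
  intro d
  constructor
  · change K0.fil B d ≤ (K0.fil (F.obj B) d).comap (K0.map hF B)
    rw [K0.fil, AddSubgroup.closure_le]
    rintro _ ⟨X, hX, rfl⟩
    exact AddSubgroup.subset_closure ⟨(Over.post F).obj X, (hdim X.left).trans hX, K0.map_mk hF X⟩
  · change K0.filLT B d ≤ (K0.filLT (F.obj B) d).comap (K0.map hF B)
    rw [K0.filLT, AddSubgroup.closure_le]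
    rintro _ ⟨X, hX, rfl⟩
    exact AddSubgroup.subset_closure ⟨(Over.post F).obj X, (hdim X.left).trans_lt hX, K0.map_mk hF X⟩

/-- The class map commutes with functors that respect dimension and relative dimension. -/
lemma map_classMap {F : EqSch k ⥤ EqSch k} (hF : IsGeometric F)
    (hs : ∀ (d : ℕ) (X : EqSch k), SmoothOfRelativeDimension d X.sch.hom →
      SmoothOfRelativeDimension d (F.obj X).sch.hom) (B : EqSch k)
    (h : PreservesFil (K0.map hF B)) (x : Burn B) :
    GrK0.map (K0.map hF B) h (classMap B x) = classMap (F.obj B) (Burn.map hF B x) := by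
  -- Both composites are homomorphisms on the Burnside group, so they need only be compared on
  -- schemes of pure dimension. There `IsClassMap` evaluates each side.
  refine DFunLike.congr_fun (f := (GrK0.map (K0.map hF B) h).comp (classMap B))
    (g := (classMap (F.obj B)).comp (Burn.map hF B)) (Burn.hom_ext_of_pure fun d X hX => ?_) x
  obtain ⟨h1, e1⟩ := isClassMap_classMap B d X hX
  obtain ⟨h2, e2⟩ := isClassMap_classMap (F.obj B) d (SmoothOver.map hF X) (hs d _ hX)
  have e3 : Burn.map hF B (Burn.mk X) = Burn.mk (SmoothOver.map hF X) :=
    congrArg QuotientAddGroup.mk (FreeAbelianGroup.map_of_apply X)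
  rw [AddMonoidHom.comp_apply, AddMonoidHom.comp_apply, e1, e3, e2, GrK0.map, GrK0.mk,
    DirectSum.map_of]
  refine congrArg _ (congrArg QuotientAddGroup.mk (Subtype.ext ?_))
  exact K0.map_mk hF X.1

/-! ### The functor `ρ̃_n` and dimensions -/

/-- The `n` rational points exhaust `Z_n`, and the `i`-th copy of `X` is the fibre of the projection
to `Z_n` over the `i`-th of them. -/
lemma exists_mem_range_copyIncl (X : Over (Spec (CommRingCat.of k))) (n : ℕ)
    (x : (prodZn X n).left) : ∃ i, x ∈ Set.range (copyIncl X n i).left := by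
  have := isIso_desc_ZnPoint (k := k) n
  obtain ⟨y, hy⟩ := (Sigma.desc (fun i : Fin n => ZnPoint k n i)).homeomorph.surjective
    ((prodZnSnd X n).left x)
  obtain ⟨i, z, rfl⟩ := Scheme.Cover.exists_eq (sigmaOpenCover _) y
  refine ⟨i, ?_⟩
  have hr := Scheme.image_preimage_eq_of_isPullback (copyIncl_isPullback X n i) Set.univ
  rw [Set.preimage_univ, Set.image_univ, Set.image_univ] at hr
  refine hr.ge ⟨z, Eq.trans ?_ hy⟩
  exact congrArg (fun g : Spec (CommRingCat.of k) ⟶ (Zn k n).left => g z)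
    (Sigma.ι_desc (fun i : Fin n => ZnPoint k n i) i).symm

lemma isOpenImmersion_copyIncl (X : Over (Spec (CommRingCat.of k))) (n : ℕ) (i : Fin n) :
    IsOpenImmersion (copyIncl X n i).left :=
  MorphismProperty.of_isPullback (P := @IsOpenImmersion) (copyIncl_isPullback X n i)
    (isOpenImmersion_ZnPoint n i)

/-- The copies of `X` are open and cover the product, so they serve as charts. For `n = 0` the
product is empty and the inequality can be strict. -/
lemma topologicalKrullDim_prodZn_le (X : Over (Spec (CommRingCat.of k))) (n : ℕ) :
    topologicalKrullDim (prodZn X n).left ≤ topologicalKrullDim X.left := by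
  refine topologicalKrullDim_le_of_forall_exists_isOpenEmbedding _ fun x => ?_
  obtain ⟨i, hi⟩ := exists_mem_range_copyIncl X n x
  have := isOpenImmersion_copyIncl X n i
  exact ⟨X.left, inferInstance, _, (copyIncl X n i).left.isOpenEmbedding, hi, le_rfl⟩

/-- The projection to `X` is étale, hence of relative dimension `0`, and relative dimensions add
under composition. -/
lemma smoothOfRelativeDimension_prodZn (d : ℕ) (X : Over (Spec (CommRingCat.of k))) (n : ℕ)
    (h : SmoothOfRelativeDimension d X.hom) : SmoothOfRelativeDimension d (prodZn X n).hom := by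
  have h0 : SmoothOfRelativeDimension 0 (prodZnFst X n).left :=
    inferInstance
  rw [← zero_add d]
  exact inferInstanceAs (SmoothOfRelativeDimension (0 + d) ((prodZnFst X n).left ≫ X.hom))

end BostConnes

end

theorem proposition4p5 (k : Type u) [Field k] [CharZero k] :
    ∃ Ψ : ∀ B : BostConnes.EqSch k, BostConnes.Burn B →+ BostConnes.GrK0 B,
      (∀ B : BostConnes.EqSch k, BostConnes.IsClassMap (Ψ B)) ∧
      (∀ (B : BostConnes.EqSch k) (Ψ' : BostConnes.Burn B →+ BostConnes.GrK0 B),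
        BostConnes.IsClassMap Ψ' → Ψ' = Ψ B) ∧
      ∀ (B : BostConnes.EqSch k) (n : ℕ) (hn : 0 < n),
        (∃ hσ : BostConnes.PreservesFil (BostConnes.K0.sigma n B).toAddMonoidHom,
          ∀ x : BostConnes.Burn B,
            BostConnes.GrK0.map (BostConnes.K0.sigma n B).toAddMonoidHom hσ (Ψ B x) =
              Ψ ((BostConnes.EqSch.sigma n).obj B) (BostConnes.Burn.sigma n B x)) ∧
        (∃ hρ : BostConnes.PreservesFil (BostConnes.K0.rho n hn B),
          ∀ x : BostConnes.Burn B,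
            BostConnes.GrK0.map (BostConnes.K0.rho n hn B) hρ (Ψ B x) =
              Ψ ((BostConnes.EqSch.rho n hn).obj B) (BostConnes.Burn.rho n hn B x)) := by
  refine ⟨BostConnes.classMap, BostConnes.isClassMap_classMap,
    fun B Ψ' h => BostConnes.eq_classMap h, fun B n hn => ⟨?_, ?_⟩⟩
  -- Only the action changes under `σ_n`, so dimension and relative dimension are literally the
  -- same. As an additive map `K0.sigma` is `K0.map` by definition.
  · have h := BostConnes.preservesFil_map (BostConnes.isGeometric_sigma n)
      (fun _ => le_rfl) B
    exact ⟨h, BostConnes.map_classMap (BostConnes.isGeometric_sigma n) (fun _ _ hX => hX) B h⟩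
  · have h := BostConnes.preservesFil_map (BostConnes.isGeometric_rho n hn)
      (fun X => BostConnes.topologicalKrullDim_prodZn_le X.sch n) B
    exact ⟨h, BostConnes.map_classMap (BostConnes.isGeometric_rho n hn)
      (fun d X hX => BostConnes.smoothOfRelativeDimension_prodZn d X.sch n hX) B h⟩
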